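/- For $n\ge 0$ let $\beta(x,y)=x^{T}S_n y$ be the symmetric bilinear form on $\mathbb{C}^n$, where $S_n$ is the permutation matrix sending $e_i$ to $e_{n+1-i}$. Let $SO(n)$ be the group of all $g\in SL(n,\mathbb{C})$ preserving $\beta$, and let $\mathfrak{so}(n)$ be the Lie algebra of all $n\times n$ complex matrices $Z$ with $\beta(Zx,y)=-\beta(x,Zy)$ for all $x,y\in\mathbb{C}^n$. Let $\mathcal{B}_{\mathfrak{so}(n)}$ be the set of all Borel subalgebras (maximal solvable subalgebras) of $\mathfrak{so}(n)$, on which $SO(n)$ acts by $g\cdot\mathfrak{b}=g\mathfrak{b}g^{-1}$. For $\ell\ge 0$ regard $SO(2\ell)$ as the subgroup of those elements of $SO(2\ell+1)$ that fix the middle basis vector $e_{\ell+1}$, and let $B_{SO(2\ell)}\subset SO(2\ell)$ be its standard Borel subgroup, consisting of the elements of this subgroup that are upper triangular matrices in $SO(2\ell+1)$. Then for every $\ell\ge 0$ the set $B_{SO(2\ell)}\backslash\mathcal{B}_{\mathfrak{so}(2\ell+1)}$ of $B_{SO(2\ell)}$-orbits on $\mathcal{B}_{\mathfrak{so}(2\ell+1)}$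 is finite, and the exponential generating function of the sequence of its cardinalities is $$\sum_{\ell\ge 0}\frac{|B_{SO(2\ell)}\backslash\mathcal{B}_{\mathfrak{so}(2\ell+1)}|}{\ell!}\,x^{\ell}=\frac{e^{\frac{x}{1-2x}}}{1-2x}$$ as formal power series in $x$. -/

import Mathlib

open scoped Nat Matrix

noncomputable section

namespace OrthoFlag

attribute [local instance 100] LieRing.ofAssociativeRing

/-- The permutation matrix `S_n` sending `e_i` to `e_{n+1-i}`. -/
def antidiag (n : ℕ) : Matrix (Fin n) (Fin n) ℂ :=
  fun i j => if i = Fin.rev j then 1 else 0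

/-- The nondegenerate symmetric bilinear form `β(x, y) = xᵀ S_n y` on `ℂⁿ`. -/
def form (n : ℕ) (x y : Fin n → ℂ) : ℂ := x ⬝ᵥ (antidiag n *ᵥ y)

/-- The special orthogonal group `SO(n)` of the form `β`, as a subgroup of `SL(n, ℂ)`. -/
def SO (n : ℕ) : Subgroup (Matrix.SpecialLinearGroup (Fin n) ℂ) where
  carrier := {g | ∀ x y : Fin n → ℂ, form n (g.1 *ᵥ x) (g.1 *ᵥ y) = form n x y}
  one_mem' := by intro x y; simp
  mul_mem' := by
    intro g h hg hh x y
    have e : ∀ z : Fin n → ℂ, (g * h).1 *ᵥ z = g.1 *ᵥ (h.1 *ᵥ z) := fun z => by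
      simp [Matrix.mulVec_mulVec]
    rw [e, e, hg, hh]
  inv_mem' := by
    intro g hg x y
    have e : ∀ z : Fin n → ℂ, g.1 *ᵥ ((g⁻¹).1 *ᵥ z) = z := fun z => by
      have h : g.1 * (g⁻¹).1 = 1 := congrArg Subtype.val (mul_inv_cancel g)
      rw [Matrix.mulVec_mulVec, h, Matrix.one_mulVec]
    have h := hg ((g⁻¹).1 *ᵥ x) ((g⁻¹).1 *ᵥ y)
    rw [e, e] at h
    exact h.symm

/-- The orthogonal Lie algebra `𝔰𝔬(n) = {Z ∈ 𝔤𝔩(n) | β(Zx, y) = -β(x, Zy) for all x, y}`,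
with the commutator bracket. -/
def so (n : ℕ) : LieSubalgebra ℂ (Matrix (Fin n) (Fin n) ℂ) where
  carrier := {Z | ∀ x y : Fin n → ℂ, form n (Z *ᵥ x) y = -form n x (Z *ᵥ y)}
  zero_mem' := by intro x y; simp [form]
  add_mem' := by
    intro Z Z' h h' x y
    have a := h x y
    have b := h' x y
    simp only [form, Matrix.add_mulVec, Matrix.mulVec_add, add_dotProduct, dotProduct_add]
      at a b ⊢
    rw [a, b]; ring
  smul_mem' := by
    intro c Z h x y
    have a := h x y
    simp only [form, Matrix.smul_mulVec, Matrix.mulVec_smul, smul_dotProduct, dotProduct_smul]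
      at a ⊢
    rw [a]; simp
  lie_mem' := by
    intro Z Z' h h' x y
    have a : form n (Z *ᵥ (Z' *ᵥ x)) y = form n x (Z' *ᵥ (Z *ᵥ y)) := by
      rw [h, h', neg_neg]
    have b : form n (Z' *ᵥ (Z *ᵥ x)) y = form n x (Z *ᵥ (Z' *ᵥ y)) := by
      rw [h', h, neg_neg]
    simp only [form, Ring.lie_def, Matrix.sub_mulVec, Matrix.mulVec_sub, sub_dotProduct,
      dotProduct_sub, ← Matrix.mulVec_mulVec] at a b ⊢
    rw [a, b]; ring

lemma conj_mem_so {n : ℕ} (g : SO n) (Z : so n) :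
    g.1.1 * Z.1 * (g⁻¹).1.1 ∈ so n := by
  intro x y
  have e : ∀ z : Fin n → ℂ, g.1.1 *ᵥ ((g⁻¹).1.1 *ᵥ z) = z := fun z => by
    have h : g.1.1 * (g⁻¹).1.1 = 1 :=
      congrArg (fun k : SO n => k.1.1) (mul_inv_cancel g)
    rw [Matrix.mulVec_mulVec, h, Matrix.one_mulVec]
  have hg := g.2
  have hZ := Z.2 ((g⁻¹).1.1 *ᵥ x) ((g⁻¹).1.1 *ᵥ y)
  rw [← hg, ← hg ((g⁻¹).1.1 *ᵥ x), e, e] at hZ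
  simpa only [Matrix.mulVec_mulVec, mul_assoc] using hZ

lemma coe_mul_inv {n : ℕ} (g : SO n) : g.1.1 * (g⁻¹).1.1 = 1 :=
  congrArg (fun k : SO n => k.1.1) (mul_inv_cancel g)

lemma coe_inv_mul {n : ℕ} (g : SO n) : (g⁻¹).1.1 * g.1.1 = 1 :=
  congrArg (fun k : SO n => k.1.1) (inv_mul_cancel g)

/-- The adjoint action `Ad(g) Z = g Z g⁻¹` of `SO(n)` on `𝔰𝔬(n)`. -/
def Ad {n : ℕ} (g : SO n) : so n ≃ₗ⁅ℂ⁆ so n where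
  toFun Z := ⟨g.1.1 * Z.1 * (g⁻¹).1.1, conj_mem_so g Z⟩
  invFun Z := ⟨(g⁻¹).1.1 * Z.1 * g.1.1, by simpa using conj_mem_so g⁻¹ Z⟩
  map_add' Z Z' := by
    apply Subtype.ext
    simp [mul_add, add_mul]
  map_smul' c Z := by
    apply Subtype.ext
    simp
  map_lie' := by
    intro Z Z'
    apply Subtype.ext
    have key : ∀ A B : Matrix (Fin n) (Fin n) ℂ,
        g.1.1 * A * (g⁻¹).1.1 * (g.1.1 * B * (g⁻¹).1.1) = g.1.1 * (A * B) * (g⁻¹).1.1 := by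
      intro A B
      calc _ = g.1.1 * A * ((g⁻¹).1.1 * g.1.1) * B * (g⁻¹).1.1 := by noncomm_ring
        _ = _ := by rw [coe_inv_mul]; noncomm_ring
    simp only [LieSubalgebra.coe_bracket, Ring.lie_def, key]
    noncomm_ring
  left_inv Z := by
    apply Subtype.ext
    calc (g⁻¹).1.1 * (g.1.1 * Z.1 * (g⁻¹).1.1) * g.1.1
        = ((g⁻¹).1.1 * g.1.1) * Z.1 * ((g⁻¹).1.1 * g.1.1) := by noncomm_ring
      _ = Z.1 := by rw [coe_inv_mul]; simp
  right_inv Z := by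
    apply Subtype.ext
    calc g.1.1 * ((g⁻¹).1.1 * Z.1 * g.1.1) * (g⁻¹).1.1
        = (g.1.1 * (g⁻¹).1.1) * Z.1 * (g.1.1 * (g⁻¹).1.1) := by noncomm_ring
      _ = Z.1 := by rw [coe_mul_inv]; simp

lemma coe_Ad {n : ℕ} (g : SO n) (Z : so n) :
    (Ad g Z).1 = g.1.1 * Z.1 * (g⁻¹).1.1 := rfl

/-- The set `𝓑_𝔤` of all Borel subalgebras (maximal solvable subalgebras) of a complex Lie
algebra `𝔤`. -/
def BorelSubalgebra (L : Type*) [LieRing L] [LieAlgebra ℂ L] : Type _ :=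
  {b : LieSubalgebra ℂ L // Maximal (fun s : LieSubalgebra ℂ L => LieAlgebra.IsSolvable s) b}

lemma isSolvable_map {L : Type*} [LieRing L] [LieAlgebra ℂ L] (e : L ≃ₗ⁅ℂ⁆ L)
    {s : LieSubalgebra ℂ L} (h : LieAlgebra.IsSolvable s) :
    LieAlgebra.IsSolvable (s.map (e : L →ₗ⁅ℂ⁆ L)) :=
  (LieAlgebra.solvable_iff_equiv_solvable (e.lieSubalgebraMap s)).mp h

lemma maximal_map {L : Type*} [LieRing L] [LieAlgebra ℂ L] (e : L ≃ₗ⁅ℂ⁆ L)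
    {b : LieSubalgebra ℂ L}
    (h : Maximal (fun s : LieSubalgebra ℂ L => LieAlgebra.IsSolvable s) b) :
    Maximal (fun s : LieSubalgebra ℂ L => LieAlgebra.IsSolvable s)
      (b.map (e : L →ₗ⁅ℂ⁆ L)) := by
  refine ⟨isSolvable_map e h.1, fun s hs hle => ?_⟩
  have h1 : b ≤ s.map (e.symm : L →ₗ⁅ℂ⁆ L) := by
    intro x hx
    exact ⟨e x, hle ⟨x, hx, rfl⟩, e.symm_apply_apply x⟩
  have h2 := h.2 (isSolvable_map e.symm hs) h1
  intro y hy
  exact ⟨e.symm y, h2 ⟨y, hy, rfl⟩, e.apply_symm_apply y⟩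

/-- `SO(n)` acts on the set of Borel subalgebras of `𝔰𝔬(n)` by `g • 𝔟 = Ad(g) 𝔟`. -/
instance (n : ℕ) : MulAction (SO n) (BorelSubalgebra (so n)) where
  smul g b := ⟨b.1.map (Ad g : so n →ₗ⁅ℂ⁆ so n), maximal_map (Ad g) b.2⟩
  one_smul b := by
    have h : ∀ Z : so n, Ad (1 : SO n) Z = Z := fun Z => Subtype.ext (by
      rw [coe_Ad]; simp)
    apply Subtype.ext
    ext Z
    constructor
    · rintro ⟨Y, hY, rfl⟩
      exact (h Y).symm ▸ hY
    · intro hZ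
      exact ⟨Z, hZ, h Z⟩
  mul_smul g g' b := by
    have h : ∀ Z : so n, Ad (g * g') Z = Ad g (Ad g' Z) := fun Z => Subtype.ext (by
      rw [coe_Ad, coe_Ad, coe_Ad]; simp [mul_assoc])
    apply Subtype.ext
    ext Z
    constructor
    · rintro ⟨Y, hY, rfl⟩
      exact ⟨Ad g' Y, ⟨Y, hY, rfl⟩, (h Y).symm⟩
    · rintro ⟨_, ⟨Y, hY, rfl⟩, rfl⟩
      exact ⟨Y, hY, h Y⟩

/-- The standard Borel subgroup `B_n` of upper triangular matrices in `SO(n)`. -/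
def upperBorel (n : ℕ) : Subgroup (SO n) where
  carrier := {g | g.1.1.BlockTriangular id}
  one_mem' := Matrix.blockTriangular_one
  mul_mem' hg hh := Matrix.BlockTriangular.mul hg hh
  inv_mem' := by
    intro g hg
    have e : (g⁻¹).1.1 = (g.1.1)⁻¹ := (Matrix.inv_eq_right_inv (coe_mul_inv g)).symm
    have : Invertible g.1.1 := ⟨_, coe_inv_mul g, coe_mul_inv g⟩
    change (g⁻¹).1.1.BlockTriangular id
    rw [e]
    exact Matrix.blockTriangular_inv_of_blockTriangular hg

/-- The middle vector `e_0` of the standard basis of `ℂ^{2ℓ+1}`; it satisfies `β(e_0, e_0) = 1`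
and is orthogonal to the other basis vectors. -/
def middleVec (l : ℕ) : Fin (2 * l + 1) → ℂ := Pi.single ⟨l, by omega⟩ 1

/-- The subgroup `K = SO(2ℓ)` of `SO(2ℓ+1)`: the elements that fix `e_0`, that is, those which
act on `ℂ^{2ℓ+1} = ℂ e_0 ⊕ e_0^⊥` as the identity on `ℂ e_0` and as an element of the special
orthogonal group of the `2ℓ`-dimensional space `e_0^⊥`. -/
def K (l : ℕ) : Subgroup (SO (2 * l + 1)) where
  carrier := {g | g.1.1 *ᵥ middleVec l = middleVec l}
  one_mem' := Matrix.one_mulVec _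
  mul_mem' := by
    intro g h (hg : _ = _) (hh : _ = _)
    change (g.1.1 * h.1.1) *ᵥ middleVec l = middleVec l
    rw [← Matrix.mulVec_mulVec, hh, hg]
  inv_mem' := by
    intro g (hg : _ = _)
    change (g⁻¹).1.1 *ᵥ middleVec l = middleVec l
    conv_lhs => rw [← hg]
    rw [Matrix.mulVec_mulVec, coe_inv_mul, Matrix.one_mulVec]

/-- The standard Borel subgroup `B_{SO(2ℓ)} = K ∩ B_{2ℓ+1}` of `K = SO(2ℓ)`. -/
def borelSOEven (l : ℕ) : Subgroup (SO (2 * l + 1)) := K l ⊓ upperBorel (2 * l + 1)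

/-- The orbit set `B_{SO(2ℓ)} \ 𝓑_{𝔰𝔬(2ℓ+1)}`. -/
abbrev OrbitSet (l : ℕ) : Type :=
  MulAction.orbitRel.Quotient (borelSOEven l) (BorelSubalgebra (so (2 * l + 1)))

/-- The exponential generating function `∑ f(n)/n! xⁿ` of a sequence of complex numbers, as a
formal power series. -/
def expGenFun (f : ℕ → ℂ) : PowerSeries ℂ := PowerSeries.mk fun n => f n / (n ! : ℂ)

end OrthoFlag

end

/-! Write G = SO(2ℓ+1), B for its upper triangular subgroup, e_0 for the middle basis vector and *
for the adjoint with respect to β. All Borel subalgebras of the Lie algebra are conjugate and the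
standard one has stabilizer B, so the orbits are the double cosets B_K\G/B, where B_K is the
stabilizer of e_0 in B.

Conjugacy comes from Lie's theorem: a solvable subalgebra stabilizes an isotropic flag of length ℓ
(`exists_isotropic_flag`), and an adapted basis can be chosen with triangular Gram matrix. It is
made orthogonal by a polar decomposition g = kh (`exists_polar`), with k orthogonal and h² = g*g.
Since h is a polynomial in g*g, it inherits every triangular shape of g*g. The same device deduces
the Bruhat decomposition of the orthogonal group from that of GL (`exists_bruhat_orth`).

B moves e_0 through all of e_0 + ⟨e_i : i < ℓ⟩. Hence, inside BwB with w the matrix of a signed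
permutation σ, the double cosets correspond to the orbits of B ∩ wBw⁻¹ on this affine space.
Coordinates i for which σ⁻¹i precedes the middle are cleared by unipotent elements. On the others
only matrices triangular for both orders, i ≤ j and σ⁻¹i ≤ σ⁻¹j, are available, and a complete
invariant is the set A of maximal elements of the support for the intersection of the two orders: an
antichain, on which σ⁻¹ is decreasing (`exists_normal_form`, `exists_le_of_mulVec_eq`). So orbits
are pairs (σ, A) (`datumOrbit_bijective`).

If |A| = k, the signs off A are free, giving 2^(ℓ-k), and the underlying permutation must be
increasing on A, giving ℓ!/k!. The sum of C(ℓ,k) 2^(ℓ-k) ℓ!/k! over k, divided by ℓ!, is the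
coefficient of x^ℓ in ∑ x^k / (k! (1-2x)^(k+1)), which is the stated series. -/

namespace OrthoFlag

open Matrix

/-! ### The adjoint with respect to β, and block triangularity -/

section Adjoint

variable {n : ℕ}

/-- The adjoint of a matrix with respect to the form `β`: the reflection in the antidiagonal. -/
def adj (M : Matrix (Fin n) (Fin n) ℂ) : Matrix (Fin n) (Fin n) ℂ :=
  Mᵀ.submatrix Fin.rev Fin.rev

lemma adj_apply (M : Matrix (Fin n) (Fin n) ℂ) (i j : Fin n) :
    adj M i j = M j.rev i.rev := rfl

@[simp] lemma adj_adj (M : Matrix (Fin n) (Fin n) ℂ) : adj (adj M) = M := by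
  ext i j; simp [adj_apply]

@[simp] lemma adj_one : adj (1 : Matrix (Fin n) (Fin n) ℂ) = 1 := by
  ext i j; simp [adj_apply, Matrix.one_apply, eq_comm]

lemma adj_mul (M N : Matrix (Fin n) (Fin n) ℂ) : adj (M * N) = adj N * adj M := by
  ext i j
  simp only [adj_apply, Matrix.mul_apply]
  refine Fintype.sum_equiv Fin.revPerm _ _ fun k => ?_
  simp [mul_comm]

lemma adj_add (M N : Matrix (Fin n) (Fin n) ℂ) : adj (M + N) = adj M + adj N := rfl

lemma adj_sub (M N : Matrix (Fin n) (Fin n) ℂ) : adj (M - N) = adj M - adj N := rfl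

lemma adj_neg (M : Matrix (Fin n) (Fin n) ℂ) : adj (-M) = -adj M := rfl

lemma adj_smul (c : ℂ) (M : Matrix (Fin n) (Fin n) ℂ) : adj (c • M) = c • adj M := rfl

lemma adj_vecMulVec (x y : Fin n → ℂ) :
    adj (vecMulVec x y) = vecMulVec (y ∘ Fin.rev) (x ∘ Fin.rev) := by
  ext i j; simp [adj_apply, vecMulVec_apply, mul_comm]

lemma det_adj (M : Matrix (Fin n) (Fin n) ℂ) : (adj M).det = M.det := by
  change (Mᵀ.submatrix Fin.revPerm Fin.revPerm).det = _
  rw [det_submatrix_equiv_self, det_transpose]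

lemma adj_pow (M : Matrix (Fin n) (Fin n) ℂ) (k : ℕ) : adj (M ^ k) = adj M ^ k := by
  induction k with
  | zero => simp
  | succ k ih => rw [pow_succ, adj_mul, ih, ← pow_succ']

lemma adj_aeval (M : Matrix (Fin n) (Fin n) ℂ) (p : Polynomial ℂ) :
    adj (Polynomial.aeval M p) = Polynomial.aeval (adj M) p := by
  induction p using Polynomial.induction_on' with
  | add p q hp hq => simp only [map_add, adj_add, hp, hq]
  | monomial k c =>
    simp only [Polynomial.aeval_monomial, ← Algebra.smul_def, adj_smul, adj_pow]

lemma form_eq_sum (x y : Fin n → ℂ) : form n x y = ∑ i, x i * y i.rev := by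
  have h : ∀ i, (antidiag n *ᵥ y) i = y i.rev := fun i => by
    simp only [mulVec, dotProduct, antidiag, ite_mul, one_mul, zero_mul]
    rw [Finset.sum_eq_single i.rev]
    · simp
    · intro b _ hb
      rw [if_neg]
      rintro rfl
      exact hb (Fin.rev_rev b).symm
    · simp
  simp [form, dotProduct, h]

lemma form_single_left (i : Fin n) (x : Fin n → ℂ) :
    form n (Pi.single i 1) x = x i.rev := by
  rw [form_eq_sum, Finset.sum_eq_single i] <;> simp +contextual

lemma form_comm (x y : Fin n → ℂ) : form n x y = form n y x := by
  rw [form_eq_sum, form_eq_sum]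
  refine Fintype.sum_equiv Fin.revPerm _ _ fun k => ?_
  simp [mul_comm]

lemma form_mulVec_left (M : Matrix (Fin n) (Fin n) ℂ) (x y : Fin n → ℂ) :
    form n (M *ᵥ x) y = form n x (adj M *ᵥ y) := by
  simp only [form_eq_sum, mulVec, dotProduct, Finset.sum_mul, Finset.mul_sum, adj_apply]
  rw [Finset.sum_comm]
  refine Finset.sum_congr rfl fun i _ => ?_
  refine Fintype.sum_equiv Fin.revPerm _ _ fun k => ?_
  simp [mul_comm, mul_left_comm]

lemma eq_of_form_eq {M N : Matrix (Fin n) (Fin n) ℂ}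
    (h : ∀ x y, form n x (M *ᵥ y) = form n x (N *ᵥ y)) : M = N := by
  ext i j
  have := h (Pi.single i.rev 1) (Pi.single j 1)
  simpa [form_single_left] using this

lemma mem_SO_iff (g : Matrix.SpecialLinearGroup (Fin n) ℂ) :
    g ∈ SO n ↔ adj g.1 * g.1 = 1 := by
  constructor
  · intro h
    refine eq_of_form_eq fun x y => ?_
    have := h x y
    rw [form_mulVec_left, mulVec_mulVec] at this
    rw [this, one_mulVec]
  · intro h x y
    rw [form_mulVec_left, mulVec_mulVec, h, one_mulVec]

lemma mem_so_iff (Z : Matrix (Fin n) (Fin n) ℂ) : Z ∈ so n ↔ adj Z = -Z := by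
  constructor
  · intro h
    refine eq_of_form_eq fun x y => ?_
    have := h x y
    rw [form_mulVec_left] at this
    rw [this, neg_mulVec, form_eq_sum, form_eq_sum]
    simp
  · intro h x y
    rw [form_mulVec_left, h, neg_mulVec, form_eq_sum, form_eq_sum]
    simp

/-- The adjoint moves entry (i, j) to (rev j, rev i), and `Fin.rev` reverses the order. A general
`b` is kept because both `id` and `σ.symm` are needed later. -/
lemma BlockTriangular_adj {M : Matrix (Fin n) (Fin n) ℂ} {b : Fin n → Fin n}
    (hb : ∀ i, b i.rev = (b i).rev) (hM : M.BlockTriangular b) : (adj M).BlockTriangular b := by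
  intro i j h
  apply hM
  rw [hb, hb]
  exact Fin.rev_lt_rev.mpr h

lemma BlockTriangular_aeval {M : Matrix (Fin n) (Fin n) ℂ} {b : Fin n → Fin n}
    (hM : M.BlockTriangular b) (p : Polynomial ℂ) :
    (Polynomial.aeval M p).BlockTriangular b := by
  have hp : ∀ k : ℕ, (M ^ k).BlockTriangular b := fun k => by
    induction k with
    | zero => simpa using blockTriangular_one
    | succ k ih => rw [pow_succ]; exact ih.mul hM
  induction p using Polynomial.induction_on' with
  | add p q hp hq => rw [map_add]; exact hp.add hq
  | monomial k c =>
    rw [Polynomial.aeval_monomial, ← Algebra.smul_def]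
    intro i j hij
    simp [hp k hij]

lemma BlockTriangular_inv {M : Matrix (Fin n) (Fin n) ℂ} {b : Fin n → Fin n}
    (hM : M.BlockTriangular b) : M⁻¹.BlockTriangular b := by
  by_cases h : IsUnit M.det
  · have : Invertible M := M.invertibleOfIsUnitDet h
    exact blockTriangular_inv_of_blockTriangular hM
  · rw [nonsing_inv_apply_not_isUnit _ h]
    exact blockTriangular_zero

end Adjoint

/-! ### Square roots of invertible matrices as polynomials in the matrix -/

section SquareRoot

open Polynomial in
-- Induction on the roots, with multiplicity. If q is the product so far and p² = X + qr, then (p +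
-- cq)² = X + q(r + 2cp + c²q), so it suffices to choose c making the last bracket vanish at the new
-- root a.
lemma exists_sq_eq_X_add (s : Multiset ℂ) (hs : ∀ a ∈ s, a ≠ 0) :
    ∃ p r : ℂ[X], p ^ 2 = X + (s.map fun a => X - C a).prod * r := by
  induction s using Multiset.induction_on with
  | empty => exact ⟨0, -X, by simp⟩
  | cons a s ih =>
    obtain ⟨p, r, h⟩ := ih fun b hb => hs b (Multiset.mem_cons_of_mem hb)
    have ha := hs a (Multiset.mem_cons_self a s)
    set q := (s.map fun a => X - C a).prod with hq
    obtain ⟨c, hc⟩ : ∃ c : ℂ, r.eval a + 2 * c * p.eval a + c ^ 2 * q.eval a = 0 := by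
      -- At a repeated root the equation for c is linear, solvable because p(a)² = a ≠ 0; otherwise
      -- it is a quadratic, solved by a square root of its reduced discriminant.
      by_cases hqa : q.eval a = 0
      · have hpa : p.eval a ≠ 0 := by
          intro h0
          have := congrArg (eval a) h
          simp [hqa, h0] at this
          exact ha this.symm
        exact ⟨-(r.eval a) / (2 * p.eval a), by rw [hqa]; field_simp; ring⟩
      · obtain ⟨d, hd⟩ := IsSquare.exists_sq _ (IsAlgClosed.exists_pow_nat_eq
            (p.eval a ^ 2 - q.eval a * r.eval a) (n := 2) (by norm_num) |>.elim
            fun z hz => ⟨z, by rw [← hz, sq]⟩ : IsSquare (p.eval a ^ 2 - q.eval a * r.eval a))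
        refine ⟨(d - p.eval a) / q.eval a, ?_⟩
        field_simp
        linear_combination -hd
    obtain ⟨t, ht⟩ : X - C a ∣ r + 2 * C c * p + C c ^ 2 * q := by
      rw [dvd_iff_isRoot]; simp [hc]
    refine ⟨p + C c * q, t, ?_⟩
    rw [Multiset.map_cons, Multiset.prod_cons, ← hq]
    linear_combination h + q * ht

/-- A square root of X modulo the characteristic polynomial gives a square root of M, by
Cayley–Hamilton. -/
lemma exists_aeval_sq_eq {n : ℕ} (M : Matrix (Fin n) (Fin n) ℂ) (hM : M.det ≠ 0) :
    ∃ p : Polynomial ℂ, Polynomial.aeval M p * Polynomial.aeval M p = M := by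
  have hs : ∀ a ∈ M.charpoly.roots, a ≠ 0 := by
    rintro a ha rfl
    apply hM
    rw [det_eq_prod_roots_charpoly]
    exact Multiset.prod_eq_zero ha
  obtain ⟨p, r, h⟩ := exists_sq_eq_X_add _ hs
  refine ⟨p, ?_⟩
  have hsp : (M.charpoly.roots.map fun a => Polynomial.X - Polynomial.C a).prod = M.charpoly :=
    ((IsAlgClosed.splits M.charpoly).eq_prod_roots_of_monic M.charpoly_monic).symm
  rw [hsp] at h
  have := congrArg (Polynomial.aeval M) h
  simpa [sq, aeval_self_charpoly] using this

end SquareRoot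

/-! ### Polar decomposition for the complex form β -/

section Polar

variable {n : ℕ}

/-- An invertible matrix `g` is an orthogonal matrix times a polynomial in `g* g`. -/
lemma exists_polar (g : Matrix (Fin n) (Fin n) ℂ) (hg : g.det ≠ 0) :
    ∃ h k : Matrix (Fin n) (Fin n) ℂ, g = k * h ∧ adj k * k = 1 ∧ h.det ≠ 0 ∧
      ∀ b : Fin n → Fin n, (adj g * g).BlockTriangular b → h.BlockTriangular b := by
  have hM : (adj g * g).det ≠ 0 := by
    rw [det_mul, det_adj]; exact mul_ne_zero hg hg
  obtain ⟨p, hp⟩ := exists_aeval_sq_eq _ hM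
  set h := Polynomial.aeval (adj g * g) p with hh
  have hd : h.det ≠ 0 := by
    intro h0
    rw [← hp, det_mul, h0, zero_mul] at hM
    exact hM rfl
  have hu : IsUnit h.det := isUnit_iff_ne_zero.mpr hd
  -- A polynomial in the self-adjoint matrix g*g is self-adjoint. With k = gh⁻¹ this gives k*k =
  -- h⁻¹(g*g)h⁻¹ = h⁻¹h²h⁻¹ = 1.
  have ha : adj h = h := by
    rw [hh, adj_aeval, adj_mul, adj_adj]
  have hi : adj h⁻¹ = h⁻¹ := by
    have : adj h⁻¹ * h = 1 := by
      nth_rw 2 [← ha]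
      rw [← adj_mul, mul_nonsing_inv _ hu, adj_one]
    exact (inv_eq_left_inv this).symm
  refine ⟨h, g * h⁻¹, ?_, ?_, hd, fun b hb => BlockTriangular_aeval hb p⟩
  · rw [mul_assoc, nonsing_inv_mul _ hu, mul_one]
  · rw [adj_mul, hi]
    calc h⁻¹ * adj g * (g * h⁻¹) = h⁻¹ * (adj g * g) * h⁻¹ := by simp only [mul_assoc]
      _ = (h⁻¹ * h) * (h * h⁻¹) := by rw [← hp]; simp only [mul_assoc]
      _ = 1 := by rw [mul_nonsing_inv _ hu, nonsing_inv_mul _ hu, one_mul]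

end Polar

end OrthoFlag

/-! ### Bruhat decomposition in GL(n) and in the orthogonal group -/

namespace OrthoFlag

open Matrix

variable {n : ℕ}

/-- The permutation matrix sending `e_j` to `e_{σ j}`. -/
def permMat (σ : Equiv.Perm (Fin n)) : Matrix (Fin n) (Fin n) ℂ :=
  (1 : Matrix (Fin n) (Fin n) ℂ).submatrix σ.symm id

lemma permMat_mul_apply (σ : Equiv.Perm (Fin n)) (M : Matrix (Fin n) (Fin n) ℂ) (i j : Fin n) :
    (permMat σ * M) i j = M (σ.symm i) j := by
  simp [permMat, Matrix.mul_apply, Matrix.one_apply]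

lemma mul_permMat_apply (σ : Equiv.Perm (Fin n)) (M : Matrix (Fin n) (Fin n) ℂ) (i j : Fin n) :
    (M * permMat σ) i j = M i (σ j) := by
  simp [permMat, Matrix.mul_apply, Matrix.one_apply, Equiv.symm_apply_eq]

lemma permMat_mul_permMat_inv (σ : Equiv.Perm (Fin n)) : permMat σ * permMat σ⁻¹ = 1 := by
  ext i j
  rw [permMat_mul_apply]
  simp [permMat, Matrix.one_apply, Equiv.Perm.inv_def]

lemma permMat_inv_mul_permMat (σ : Equiv.Perm (Fin n)) : permMat σ⁻¹ * permMat σ = 1 := by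
  simpa using permMat_mul_permMat_inv σ⁻¹

lemma exists_last_ne_zero {v : Fin n → ℂ} (hv : v ≠ 0) :
    ∃ i, v i ≠ 0 ∧ ∀ k, i < k → v k = 0 := by
  classical
  obtain ⟨i, hi⟩ := Function.ne_iff.mp hv
  obtain ⟨m, hm⟩ := (Finset.univ.filter fun i => v i ≠ 0).exists_maximal ⟨i, by simpa using hi⟩
  refine ⟨m, by simpa using hm.1, fun k hk => ?_⟩
  by_contra h
  exact absurd (hm.2 (by simpa using h) hk.le) (not_le.mpr hk)

lemma det_ne_zero_of_upper {M : Matrix (Fin n) (Fin n) ℂ} (hM : M.BlockTriangular id)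
    (h : ∀ i, M i i ≠ 0) : M.det ≠ 0 := by
  rw [det_of_isUpperTriangular hM]
  exact Finset.prod_ne_zero_iff.mpr fun i _ => h i

lemma diag_ne_zero_of_upper {M : Matrix (Fin n) (Fin n) ℂ} (hM : M.BlockTriangular id)
    (h : M.det ≠ 0) (i : Fin n) : M i i ≠ 0 := by
  rw [det_of_isUpperTriangular hM] at h
  exact Finset.prod_ne_zero_iff.mp h i (Finset.mem_univ i)

/-- The Bruhat decomposition in `GL(n)`. -/
lemma exists_bruhat_GL (g : Matrix (Fin n) (Fin n) ℂ) (hg : g.det ≠ 0) :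
    ∃ (b₁ b₂ : Matrix (Fin n) (Fin n) ℂ) (σ : Equiv.Perm (Fin n)),
      b₁.BlockTriangular id ∧ b₂.BlockTriangular id ∧ b₁.det ≠ 0 ∧ b₂.det ≠ 0 ∧
      g = b₁ * permMat σ * b₂ := by
  have hinj : ∀ c : Fin n → ℂ, c ≠ 0 → g *ᵥ c ≠ 0 := fun c hc h0 =>
    hg (exists_mulVec_eq_zero_iff.mp ⟨c, hc, h0⟩)
  -- `Q j i c`: the last nonzero coordinate of c is at j and that of gc is at i. Below, `ρ j` is the
  -- least i attainable for given j.
  let Q : Fin n → Fin n → (Fin n → ℂ) → Prop := fun j i c =>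
    c j ≠ 0 ∧ (∀ k, j < k → c k = 0) ∧ (g *ᵥ c) i ≠ 0 ∧ ∀ k, i < k → (g *ᵥ c) k = 0
  have hmin : ∀ j, ∃ i, ∃ c, Q j i c ∧ ∀ i' c', Q j i' c' → i ≤ i' := by
    classical
    intro j
    obtain ⟨i, h1, h2⟩ := exists_last_ne_zero (hinj (Pi.single j 1) (by simp))
    obtain ⟨m, hm⟩ := (Finset.univ.filter fun i => ∃ c, Q j i c).exists_minimal
      ⟨i, by
        simp only [Finset.mem_filter, Finset.mem_univ, true_and]
        refine ⟨Pi.single j 1, by simp, fun k hk => by simp [hk.ne'], h1, h2⟩⟩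
    obtain ⟨c, hc⟩ : ∃ c, Q j m c := by simpa using hm.1
    refine ⟨m, c, hc, fun i' c' h' => ?_⟩
    by_contra hlt
    exact hlt (hm.2 (by simpa using ⟨c', h'⟩) (not_le.mp hlt).le)
  choose ρ c hQ hle using hmin
  -- If j < k shared a pivot row, subtracting a multiple of c_j from c_k would cancel it without
  -- disturbing coordinate k, contradicting minimality at k.
  have hne : ∀ j k, j < k → ρ j ≠ ρ k := by
    intro j k hjk he
    obtain ⟨a1, a2, a3, a4⟩ := hQ j
    obtain ⟨d1, d2, d3, d4⟩ := hQ k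
    set t := (g *ᵥ c k) (ρ k) / (g *ᵥ c j) (ρ j) with ht
    have hk : (c k - t • c j) k ≠ 0 := by simpa [a2 k hjk] using d1
    obtain ⟨i, h1, h2⟩ := exists_last_ne_zero
      (hinj (c k - t • c j) fun h0 => hk (by rw [h0]; rfl))
    have hlt : i < ρ k := by
      by_contra hge
      apply h1
      rw [mulVec_sub, mulVec_smul]
      rcases (not_lt.mp hge).eq_or_lt with e | hlt
      · rw [← e]
        simp only [Pi.sub_apply, Pi.smul_apply, smul_eq_mul, ht]
        rw [he] at a3 ⊢
        field_simp
        ring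
      · simp [d4 i hlt, a4 i (he ▸ hlt)]
    refine absurd (hle k i _ ⟨hk, fun m hm => ?_, h1, h2⟩) (not_le.mpr hlt)
    simp [d2 m hm, a2 m (hjk.trans hm)]
  have hρ : Function.Injective ρ := by
    intro j k he
    rcases lt_trichotomy j k with h | h | h
    · exact absurd he (hne j k h)
    · exact h
    · exact absurd he.symm (hne k j h)
  let σ : Equiv.Perm (Fin n) := Equiv.ofBijective ρ (Finite.injective_iff_bijective.mp hρ)
  -- The vectors c_j are the columns of an upper triangular C, and gC has the pivots of a
  -- permutation, so undoing that permutation of the columns leaves an upper triangular matrix.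
  let C : Matrix (Fin n) (Fin n) ℂ := fun i j => c j i
  have hC : C.BlockTriangular id := fun i j hij => (hQ j).2.1 i hij
  have hCd : C.det ≠ 0 := det_ne_zero_of_upper hC fun i => (hQ i).1
  have hgC : ∀ i j, (g * C) i j = (g *ᵥ c j) i := fun i j => rfl
  have hB : ∀ i k, (g * C * permMat σ⁻¹) i k = (g *ᵥ c (σ.symm k)) i := fun i k => by
    rw [mul_permMat_apply, hgC]; rfl
  have hs : ∀ k, ρ (σ.symm k) = k := fun k => σ.apply_symm_apply k
  have hBt : (g * C * permMat σ⁻¹).BlockTriangular id := fun i k hik => by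
    rw [hB]
    exact (hQ _).2.2.2 i (by rw [hs]; exact hik)
  refine ⟨g * C * permMat σ⁻¹, C⁻¹, σ, hBt, BlockTriangular_inv hC,
    det_ne_zero_of_upper hBt fun i => ?_, ?_, ?_⟩
  · rw [hB]
    have := (hQ (σ.symm i)).2.2.1
    rwa [hs] at this
  · rw [det_nonsing_inv]
    simpa using hCd
  · rw [mul_assoc _ (permMat σ⁻¹), permMat_inv_mul_permMat, mul_one, mul_assoc,
      mul_nonsing_inv _ (isUnit_iff_ne_zero.mpr hCd), mul_one]

/-- Both permutations have the same sum of values, so no inequality can be strict. -/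
lemma perm_eq_of_le {σ τ : Equiv.Perm (Fin n)} (h : ∀ i, σ i ≤ τ i) : σ = τ := by
  have hs : ∑ i, (σ i).val = ∑ i, (τ i).val := by
    rw [Equiv.sum_comp σ (fun i : Fin n => i.val), Equiv.sum_comp τ (fun i : Fin n => i.val)]
  have := (Finset.sum_eq_sum_iff_of_le fun i _ => Fin.le_def.mp (h i)).mp hs
  ext i
  exact this i (Finset.mem_univ i)

/-- Uniqueness of the permutation in the Bruhat decomposition. -/
lemma bruhat_unique {σ τ : Equiv.Perm (Fin n)} {b₁ b₂ : Matrix (Fin n) (Fin n) ℂ}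
    (h₁ : b₁.BlockTriangular id) (h₂ : b₂.BlockTriangular id) (hd : b₂.det ≠ 0)
    (h : b₁ * permMat σ = permMat τ * b₂) : σ = τ := by
  refine (perm_eq_of_le fun j => ?_).symm
  -- Entry (τ j, j) is a nonzero diagonal entry of `b₂` on the right and `b₁ (τ j) (σ j)` on the
  -- left, which forces τ j ≤ σ j.
  have e := congrFun (congrFun h (τ j)) j
  rw [mul_permMat_apply, permMat_mul_apply, Equiv.symm_apply_apply] at e
  by_contra hlt
  exact diag_ne_zero_of_upper h₂ hd j (e ▸ h₁ (not_le.mp hlt))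

lemma adj_permMat (σ : Equiv.Perm (Fin n)) :
    adj (permMat σ) = permMat (Fin.revPerm * σ * Fin.revPerm)⁻¹ := by
  ext i j
  simp only [adj_apply, permMat, submatrix_apply, Matrix.one_apply, id, Equiv.symm_apply_eq,
    Equiv.Perm.inv_def, Equiv.symm_symm, Equiv.Perm.mul_apply, Fin.revPerm_apply]
  congr 1
  rw [Fin.rev_eq_iff, eq_comm, eq_iff_iff]
  exact eq_comm

/-- A matrix preserving the form `β`. -/
def IsOrth (k : Matrix (Fin n) (Fin n) ℂ) : Prop := adj k * k = 1

lemma IsOrth.mul {k l : Matrix (Fin n) (Fin n) ℂ} (hk : IsOrth k) (hl : IsOrth l) :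
    IsOrth (k * l) := by
  unfold IsOrth at *
  rw [adj_mul, mul_assoc, ← mul_assoc (adj k), hk, one_mul, hl]

lemma IsOrth.det_ne_zero {k : Matrix (Fin n) (Fin n) ℂ} (hk : IsOrth k) : k.det ≠ 0 := by
  intro h
  have := congrArg det hk
  simp [h] at this

lemma IsOrth.inv_eq {k : Matrix (Fin n) (Fin n) ℂ} (hk : IsOrth k) : k⁻¹ = adj k :=
  inv_eq_left_inv hk

lemma IsOrth.inv {k : Matrix (Fin n) (Fin n) ℂ} (hk : IsOrth k) : IsOrth k⁻¹ := by
  unfold IsOrth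
  rw [hk.inv_eq, adj_adj, ← hk.inv_eq, mul_nonsing_inv _ (isUnit_iff_ne_zero.mpr hk.det_ne_zero)]

lemma permMat_isOrth {σ : Equiv.Perm (Fin n)} (hσ : ∀ i, σ i.rev = (σ i).rev) :
    IsOrth (permMat σ) := by
  have : Fin.revPerm * σ * Fin.revPerm = σ := by
    ext i; simp [hσ]
  rw [IsOrth, adj_permMat, this, permMat_inv_mul_permMat]

lemma adj_permMat_of_comm {σ : Equiv.Perm (Fin n)} (hσ : ∀ i, σ i.rev = (σ i).rev) :
    adj (permMat σ) = permMat σ⁻¹ := by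
  rw [← (permMat_isOrth hσ).inv_eq]
  exact inv_eq_left_inv (permMat_inv_mul_permMat σ)

/-- The Bruhat decomposition in the orthogonal group. -/
lemma exists_bruhat_orth (g : Matrix (Fin n) (Fin n) ℂ) (hg : IsOrth g) :
    ∃ (k₁ k₂ : Matrix (Fin n) (Fin n) ℂ) (σ : Equiv.Perm (Fin n)),
      k₁.BlockTriangular id ∧ k₂.BlockTriangular id ∧ IsOrth k₁ ∧ IsOrth k₂ ∧
      (∀ i, σ i.rev = (σ i).rev) ∧ g = k₁ * permMat σ * k₂ := by
  obtain ⟨b₁, b₂, σ, hb₁, hb₂, hd₁, hd₂, e⟩ := exists_bruhat_GL g hg.det_ne_zero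
  have hu₂ : IsUnit b₂.det := isUnit_iff_ne_zero.mpr hd₂
  have hu₂' : IsUnit (adj b₂).det := by rwa [det_adj]
  set X := (adj b₂)⁻¹ * b₂⁻¹ with hX
  have hXt : X.BlockTriangular id :=
    (BlockTriangular_inv (BlockTriangular_adj (b := id) (fun _ => rfl) hb₂)).mul (BlockTriangular_inv hb₂)
  have hXd : X.det ≠ 0 := by
    rw [hX, det_mul, det_nonsing_inv, det_nonsing_inv, det_adj]
    simpa using hd₂
  -- Orthogonality of g = b₁Pb₂ reads P*(b₁*b₁)P = X with X upper triangular. Moving P* across gives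
  -- two Bruhat expressions, and uniqueness makes σ commute with the reversal.
  have key : adj (permMat σ) * (adj b₁ * b₁ * permMat σ) = X := by
    have h1 : adj b₂ * (adj (permMat σ) * (adj b₁ * b₁ * permMat σ)) * b₂ = 1 := by
      rw [← hg, e]
      simp only [adj_mul, mul_assoc]
    have h2 := congrArg (fun M => (adj b₂)⁻¹ * M * b₂⁻¹) h1
    simp only [mul_one] at h2
    rw [← hX] at h2
    rw [← h2]
    simp only [← mul_assoc, nonsing_inv_mul _ hu₂', one_mul]
    simp only [mul_assoc, mul_nonsing_inv _ hu₂, mul_one]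
  have key' : adj b₁ * b₁ * permMat σ = permMat (Fin.revPerm * σ * Fin.revPerm) * X := by
    rw [← key, adj_permMat, ← mul_assoc, permMat_mul_permMat_inv, one_mul]
  have hb : (adj b₁ * b₁).BlockTriangular id :=
    (BlockTriangular_adj (b := id) (fun _ => rfl) hb₁).mul hb₁
  have hσ := bruhat_unique hb hXt hXd key'
  have hσ' : ∀ i, σ i.rev = (σ i).rev := fun i => by
    conv_lhs => rw [hσ]
    simp
  rw [← hσ] at key'
  -- Hence b₁*b₁ = PXP⁻¹ is triangular for the order transported by σ as well, and so is its square
  -- root h. Therefore h can be moved across P into the right factor.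
  have hb' : (adj b₁ * b₁).BlockTriangular σ.symm := by
    intro i j hij
    have := congrFun (congrFun key' i) (σ.symm j)
    rw [mul_permMat_apply, Equiv.apply_symm_apply, permMat_mul_apply] at this
    rw [this]
    exact hXt hij
  obtain ⟨h, k, hk, ho, hhd, ht⟩ := exists_polar b₁ hd₁
  have hP := permMat_isOrth hσ'
  have hk₂ : permMat σ⁻¹ * h * permMat σ * b₂ = (permMat σ)⁻¹ * k⁻¹ * g := by
    rw [e, hk]
    have hPi : (permMat σ)⁻¹ = permMat σ⁻¹ := inv_eq_left_inv (permMat_inv_mul_permMat σ)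
    have hki : k⁻¹ * k = 1 := nonsing_inv_mul _ (isUnit_iff_ne_zero.mpr (IsOrth.det_ne_zero ho))
    rw [hPi]
    calc _ = permMat σ⁻¹ * 1 * h * permMat σ * b₂ := by rw [mul_one]
      _ = _ := by rw [← hki]; simp only [mul_assoc]
  refine ⟨k, permMat σ⁻¹ * h * permMat σ * b₂, σ, ?_, ?_, ho, ?_, hσ', ?_⟩
  · have : k = b₁ * h⁻¹ := by
      rw [hk, mul_assoc, mul_nonsing_inv _ (isUnit_iff_ne_zero.mpr hhd), mul_one]
    rw [this]
    exact hb₁.mul (BlockTriangular_inv (ht _ hb))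
  · refine BlockTriangular.mul ?_ hb₂
    intro i j hij
    rw [mul_permMat_apply, permMat_mul_apply]
    apply ht _ hb'
    simpa [Equiv.Perm.inv_def] using hij
  · rw [hk₂]
    exact (hP.inv.mul (IsOrth.inv ho)).mul hg
  · rw [e, hk]
    simp only [← mul_assoc]
    rw [mul_assoc k (permMat σ), permMat_mul_permMat_inv, mul_one]

end OrthoFlag

namespace OrthoFlag

/-! ### Isotropic flags stable under a solvable Lie algebra -/

section LieModules

variable {L V : Type*} [LieRing L] [LieAlgebra ℂ L] [AddCommGroup V] [Module ℂ V]
  [LieRingModule L V] [LieModule ℂ L V] [FiniteDimensional ℂ V]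

/-- Lie's theorem for the quotient of two nested Lie submodules. -/
lemma exists_lie_sub_smul_mem [LieAlgebra.IsSolvable L] {W M : LieSubmodule ℂ L V} (h : W < M) :
    ∃ v ∈ M, v ∉ W ∧ ∀ x : L, ∃ c : ℂ, ⁅x, v⁆ - c • v ∈ W := by
  let N : LieSubmodule ℂ L (V ⧸ W) := M.map (LieSubmodule.Quotient.mk' W)
  obtain ⟨v₀, hv₀, hv₀'⟩ := SetLike.exists_of_lt h
  have hN : Nontrivial N := by
    refine nontrivial_of_ne ⟨LieSubmodule.Quotient.mk' W v₀,
      (LieSubmodule.mem_map _).mpr ⟨v₀, hv₀, rfl⟩⟩ 0 fun h0 => hv₀' ?_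
    have := congrArg Subtype.val h0
    exact (LieSubmodule.Quotient.mk_eq_zero W).mp this
  obtain ⟨χ, hχ⟩ := LieModule.exists_nontrivial_weightSpace_of_isSolvable ℂ L N
  obtain ⟨⟨⟨w, hw⟩, hwt⟩, hne⟩ := exists_ne (0 : LieModule.weightSpace N χ)
  obtain ⟨v, hv, rfl⟩ := (LieSubmodule.mem_map _).mp hw
  refine ⟨v, hv, fun hvW => hne ?_, fun x => ⟨χ x, ?_⟩⟩
  · apply Subtype.ext
    apply Subtype.ext
    exact (LieSubmodule.Quotient.mk_eq_zero W).mpr hvW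
  · have h1 := congrArg Subtype.val ((LieModule.mem_weightSpace χ _).mp hwt x)
    rw [← LieSubmodule.Quotient.mk_eq_zero (N := W), map_sub, map_smul, LieModuleHom.map_lie]
    exact sub_eq_zero.mpr h1

variable {B : LinearMap.BilinForm ℂ V}

/-- The orthogonal complement of a Lie submodule with respect to an invariant form. -/
def lieOrthogonal (hB : ∀ (x : L) (v w : V), B ⁅x, v⁆ w = -B v ⁅x, w⁆)
    (W : LieSubmodule ℂ L V) : LieSubmodule ℂ L V where
  __ := B.orthogonal W.toSubmodule
  lie_mem := by
    intro x m hm w hw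
    have h1 := hB x w m
    have h2 : B ⁅x, w⁆ m = 0 := hm ⁅x, w⁆ (W.lie_mem hw)
    change B w ⁅x, m⁆ = 0
    rw [h2] at h1
    linear_combination h1

/-- Lie's theorem on W^⊥/W gives a common eigenvector v₁. If it is not isotropic, its weight
vanishes, so W^⊥ ∩ v₁^⊥ is again invariant and yields v₂. If v₂ is not isotropic either, both are
killed modulo W, and so is any isotropic combination of them. -/
lemma exists_isotropic_lie_sub_smul_mem [LieAlgebra.IsSolvable L]
    (hB : ∀ (x : L) (v w : V), B ⁅x, v⁆ w = -B v ⁅x, w⁆)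
    (hs : ∀ v w, B v w = B w v) (W : LieSubmodule ℂ L V)
    (hW : ∀ v ∈ W, ∀ w ∈ W, B v w = 0)
    (hd : Module.finrank ℂ W + 3 ≤ Module.finrank ℂ (B.orthogonal W.toSubmodule)) :
    ∃ v, v ∉ W ∧ (∀ w ∈ W, B w v = 0) ∧ B v v = 0 ∧
      ∀ x : L, ∃ c : ℂ, ⁅x, v⁆ - c • v ∈ W := by
  have hle : W ≤ lieOrthogonal hB W := fun v hv w hw => hW w hw v hv
  have hlt : W < lieOrthogonal hB W := by
    refine lt_of_le_of_ne hle fun he => ?_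
    have h1 : Module.finrank ℂ W = Module.finrank ℂ (lieOrthogonal hB W) := by rw [← he]
    change _ = Module.finrank ℂ (B.orthogonal W.toSubmodule) at h1
    omega
  -- Invariance gives B(⁅x, v⁆, v) = 0. Pairing ⁅x, v⁆ - cv ∈ W with v then gives c B(v, v) = 0.
  have zero_of : ∀ v : V, (∀ w ∈ W, B w v = 0) → B v v ≠ 0 →
      (∀ x : L, ∃ c : ℂ, ⁅x, v⁆ - c • v ∈ W) → ∀ x : L, ⁅x, v⁆ ∈ W := by
    intro v hv hvv hx x
    obtain ⟨c, hc⟩ := hx x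
    have h1 := hv _ hc
    have h2 := hB x v v
    rw [hs v ⁅x, v⁆] at h2
    have h3 : B ⁅x, v⁆ v = 0 := by linear_combination h2 / 2
    simp only [map_sub, map_smul, LinearMap.sub_apply, LinearMap.smul_apply, h3,
      smul_eq_mul, zero_sub, neg_eq_zero, mul_eq_zero, hvv, or_false] at h1
    simpa [h1] using hc
  obtain ⟨v₁, hm₁, hn₁, hx₁⟩ := exists_lie_sub_smul_mem hlt
  by_cases h₁ : B v₁ v₁ = 0
  · exact ⟨v₁, hn₁, fun w hw => hm₁ w hw, h₁, hx₁⟩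
  have hz₁ := zero_of v₁ (fun w hw => hm₁ w hw) h₁ hx₁
  let M : LieSubmodule ℂ L V :=
    { toSubmodule := B.orthogonal W.toSubmodule ⊓ LinearMap.ker (B v₁)
      lie_mem := by
        rintro x m ⟨hm, hk⟩
        refine ⟨(lieOrthogonal hB W).lie_mem hm, ?_⟩
        have h1 := hB x v₁ m
        have h2 : B ⁅x, v₁⁆ m = 0 := hm _ (hz₁ x)
        rw [h2] at h1
        exact LinearMap.mem_ker.mpr (by linear_combination h1) }
  have hWM : W ≤ M := fun v hv => ⟨hle hv, by
    change B v₁ v = 0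
    rw [hs]
    exact hm₁ v hv⟩
  have hlt' : W < M := by
    refine lt_of_le_of_ne hWM fun he => ?_
    have h1 : Module.finrank ℂ W = Module.finrank ℂ M := by rw [← he]
    change _ = Module.finrank ℂ ↥(B.orthogonal W.toSubmodule ⊓ LinearMap.ker (B v₁)) at h1
    have h2 := Submodule.finrank_sup_add_finrank_inf_eq (B.orthogonal W.toSubmodule)
      (LinearMap.ker (B v₁))
    have h3 := LinearMap.finrank_range_add_finrank_ker (B v₁)
    have h4 : Module.finrank ℂ (LinearMap.range (B v₁)) ≤ 1 := by
      simpa using Submodule.finrank_le (LinearMap.range (B v₁))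
    have h5 := Submodule.finrank_le (B.orthogonal W.toSubmodule ⊔ LinearMap.ker (B v₁))
    omega
  obtain ⟨v₂, hm₂, hn₂, hx₂⟩ := exists_lie_sub_smul_mem hlt'
  by_cases h₂ : B v₂ v₂ = 0
  · exact ⟨v₂, hn₂, fun w hw => hm₂.1 w hw, h₂, hx₂⟩
  have hz₂ := zero_of v₂ (fun w hw => hm₂.1 w hw) h₂ hx₂
  have h12 : B v₁ v₂ = 0 := hm₂.2
  have h21 : B v₂ v₁ = 0 := by rw [hs, h12]
  obtain ⟨t, ht⟩ := IsAlgClosed.exists_pow_nat_eq (-(B v₁ v₁) / B v₂ v₂) (n := 2) (by norm_num)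
  have ho : ∀ w ∈ W, B w (v₁ + t • v₂) = 0 := fun w hw => by
    have a : B w v₁ = 0 := hm₁ w hw
    have b : B w v₂ = 0 := hm₂.1 w hw
    simp [a, b]
  -- The combination is outside W because its pairing with v₁ ∈ W^⊥ is B(v₁, v₁) ≠ 0.
  refine ⟨v₁ + t • v₂, fun hv => h₁ ?_, ho, ?_, fun x => ⟨0, ?_⟩⟩
  · have : B (v₁ + t • v₂) v₁ = 0 := hm₁ _ hv
    simpa [h21] using this
  · simp only [map_add, map_smul, LinearMap.add_apply, LinearMap.smul_apply, h12, h21,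
      smul_eq_mul]
    field_simp at ht
    linear_combination ht
  · rw [zero_smul, sub_zero, lie_add, lie_smul]
    exact W.add_mem (hz₁ x) (W.smul_mem t (hz₂ x))

/-- A solvable Lie algebra preserving a nondegenerate symmetric form stabilizes isotropic flags
of every dimension less than half of the dimension of the space. -/
lemma exists_isotropic_flag [LieAlgebra.IsSolvable L]
    (hB : ∀ (x : L) (v w : V), B ⁅x, v⁆ w = -B v ⁅x, w⁆)
    (hs : ∀ v w, B v w = B w v) (hn : B.Nondegenerate) (k : ℕ)
    (hk : 2 * k + 1 ≤ Module.finrank ℂ V) :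
    ∃ u : Fin k → V, LinearIndependent ℂ u ∧ (∀ i j, B (u i) (u j) = 0) ∧
      ∀ (x : L) (j : Fin k), ⁅x, u j⁆ ∈ Submodule.span ℂ (u '' Set.Iic j) := by
  induction k with
  | zero => exact ⟨Fin.elim0, linearIndependent_empty_type, fun i => i.elim0, fun _ i => i.elim0⟩
  | succ k ih =>
    obtain ⟨u, hu, hiso, hstab⟩ := ih (by omega)
    let W : LieSubmodule ℂ L V :=
      { toSubmodule := Submodule.span ℂ (Set.range u)
        lie_mem := by
          intro x m hm
          refine Submodule.span_induction (p := fun m _ => ⁅x, m⁆ ∈ Submodule.span ℂ (Set.range u))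
            ?_ ?_ ?_ ?_ hm
          · rintro _ ⟨j, rfl⟩
            exact Submodule.span_mono (Set.image_subset_range _ _) (hstab x j)
          · simp
          · intro a b _ _ ha hb
            rw [lie_add]
            exact add_mem ha hb
          · intro c a _ ha
            rw [lie_smul]
            exact Submodule.smul_mem _ c ha }
    have hWd : Module.finrank ℂ W = k := by
      change Module.finrank ℂ (Submodule.span ℂ (Set.range u)) = k
      rw [finrank_span_eq_card hu, Fintype.card_fin]
    have hWi : ∀ v ∈ W, ∀ w ∈ W, B v w = 0 := by
      intro v hv w hw
      refine Submodule.span_induction₂ (p := fun a b _ _ => B a b = 0) (s := Set.range u)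
        (t := Set.range u) ?_ ?_ ?_ ?_ ?_ ?_ ?_ hv hw
      · rintro _ _ ⟨i, rfl⟩ ⟨j, rfl⟩
        exact hiso i j
      · simp
      · simp
      · intro a b c _ _ _ h1 h2
        simp [h1, h2]
      · intro a b c _ _ _ h1 h2
        simp [h1, h2]
      · intro r a b _ _ h1
        simp [h1]
      · intro r a b _ _ h1
        simp [h1]
    have hod : Module.finrank ℂ (B.orthogonal W.toSubmodule) = Module.finrank ℂ V - k := by
      rw [LinearMap.BilinForm.finrank_orthogonal hn]
      congr 1
    -- The bound 2(k+1) + 1 ≤ dim V is exactly dim W + 3 ≤ dim W^⊥.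
    obtain ⟨v, hvW, hvo, hvv, hvx⟩ := exists_isotropic_lie_sub_smul_mem hB hs W hWi (by omega)
    refine ⟨Fin.snoc u v, hu.finSnoc hvW, fun i j => ?_, fun x j => ?_⟩
    · induction i using Fin.lastCases with
      | last =>
        induction j using Fin.lastCases with
        | last => simpa using hvv
        | cast j =>
          rw [hs]
          simpa using hvo _ (Submodule.subset_span ⟨j, rfl⟩)
      | cast i =>
        induction j using Fin.lastCases with
        | last => simpa using hvo _ (Submodule.subset_span ⟨i, rfl⟩)
        | cast j => simpa using hiso i j
    · induction j using Fin.lastCases with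
      | last =>
        obtain ⟨c, hc⟩ := hvx x
        have e : ⁅x, v⁆ = (⁅x, v⁆ - c • v) + c • v := by abel
        rw [Fin.snoc_last, e]
        refine add_mem (Submodule.span_mono ?_ hc) (Submodule.smul_mem _ c
          (Submodule.subset_span ⟨Fin.last k, by simp, by simp⟩))
        rintro _ ⟨i, rfl⟩
        exact ⟨i.castSucc, Fin.le_last _, by simp⟩
      | cast j =>
        rw [Fin.snoc_castSucc]
        refine Submodule.span_mono ?_ (hstab x j)
        rintro _ ⟨i, hi, rfl⟩
        exact ⟨i.castSucc, by simpa using hi, by simp⟩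

end LieModules

end OrthoFlag

/-! ### Conjugating solvable subalgebras into triangular form -/

namespace OrthoFlag

open Matrix

attribute [local instance 100] LieRing.ofAssociativeRing

variable {n : ℕ}

/-- The form `β` as a bilinear form. -/
noncomputable def formBilin (n : ℕ) : LinearMap.BilinForm ℂ (Fin n → ℂ) :=
  Matrix.toBilin' (antidiag n)

lemma formBilin_apply (x y : Fin n → ℂ) : formBilin n x y = form n x y :=
  Matrix.toBilin'_apply' _ _ _

lemma formBilin_nondegenerate : (formBilin n).Nondegenerate := by
  have key : ∀ x : Fin n → ℂ, (∀ y, form n y x = 0) → x = 0 := fun x hx => by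
    ext i
    have := hx (Pi.single i.rev 1)
    simpa [form_single_left] using this
  constructor
  · intro x hx
    exact key x fun y => by rw [form_comm, ← formBilin_apply]; exact hx y
  · intro x hx
    exact key x fun y => by rw [← formBilin_apply]; exact hx y

lemma span_le_orthogonal {ι V : Type*} [AddCommGroup V] [Module ℂ V]
    {B : LinearMap.BilinForm ℂ V} {u : ι → V} (h : ∀ i j, B (u i) (u j) = 0) :
    Submodule.span ℂ (Set.range u) ≤ B.orthogonal (Submodule.span ℂ (Set.range u)) := by
  rw [Submodule.span_le]
  rintro _ ⟨j, rfl⟩ w hw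
  change B w (u j) = 0
  have : Submodule.span ℂ (Set.range u) ≤ LinearMap.ker (B.flip (u j)) := by
    rw [Submodule.span_le]
    rintro _ ⟨i, rfl⟩
    exact h i j
  exact this hw

/-- An isotropic basis of half dimension extends to a basis with triangular Gram matrix. -/
lemma exists_triangular_gram {l : ℕ} (u : Fin l → Fin (2 * l + 1) → ℂ)
    (hu : LinearIndependent ℂ u) (hiso : ∀ i j, form _ (u i) (u j) = 0) :
    ∃ g : Matrix (Fin (2 * l + 1)) (Fin (2 * l + 1)) ℂ, g.det ≠ 0 ∧
      (adj g * g).BlockTriangular id ∧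
      ∀ (j : Fin l) (k : Fin (2 * l + 1)), k.val = j.val → g.col k = u j := by
  set B := formBilin (2 * l + 1) with hB
  have hiso' : ∀ i j, B (u i) (u j) = 0 := fun i j => by rw [hB, formBilin_apply, hiso]
  have hs : ∀ x y, B x y = B y x := fun x y => by
    rw [hB, formBilin_apply, formBilin_apply, form_comm]
  set W := Submodule.span ℂ (Set.range u) with hW
  have hn : Module.finrank ℂ (Fin (2 * l + 1) → ℂ) = 2 * l + 1 := by simp
  have hWd : Module.finrank ℂ W = l := by
    rw [hW, finrank_span_eq_card hu, Fintype.card_fin]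
  have hod : Module.finrank ℂ (B.orthogonal W) = l + 1 := by
    rw [LinearMap.BilinForm.finrank_orthogonal formBilin_nondegenerate, hWd, hn]
    omega
  have hle : W ≤ B.orthogonal W := span_le_orthogonal hiso'
  obtain ⟨v, hv, hvW⟩ : ∃ v ∈ B.orthogonal W, v ∉ W := by
    refine SetLike.exists_of_lt (lt_of_le_of_ne hle fun he => ?_)
    rw [← he] at hod
    omega
  have huv : ∀ i, B (u i) v = 0 := fun i => hv _ (Submodule.subset_span ⟨i, rfl⟩)
  -- Otherwise u and v would span an isotropic subspace of dimension l + 1, too large in dimension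
  -- 2l + 1.
  have hvv : B v v ≠ 0 := by
    intro h0
    have hli : LinearIndependent ℂ (Fin.snoc u v : Fin (l + 1) → _) := hu.finSnoc hvW
    have h1 : ∀ i j, B ((Fin.snoc u v : Fin (l + 1) → _) i)
        ((Fin.snoc u v : Fin (l + 1) → _) j) = 0 := by
      intro i j
      induction i using Fin.lastCases with
      | last =>
        induction j using Fin.lastCases with
        | last => simpa using h0
        | cast j =>
          rw [hs]
          simpa using huv j
      | cast i =>
        induction j using Fin.lastCases with
        | last => simpa using huv i
        | cast j => simpa using hiso' i j
    have h2 := Submodule.finrank_mono (span_le_orthogonal h1)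
    rw [LinearMap.BilinForm.finrank_orthogonal formBilin_nondegenerate,
      finrank_span_eq_card hli, hn, Fintype.card_fin] at h2
    omega
  let T : (Fin (2 * l + 1) → ℂ) →ₗ[ℂ] (Fin l → ℂ) := LinearMap.pi fun i => B (u i)
  have hT : Function.Surjective T := by
    have hk : LinearMap.ker T = B.orthogonal W := by
      ext x
      constructor
      · intro hx w hw
        have : W ≤ LinearMap.ker (B.flip x) := by
          rw [hW, Submodule.span_le]
          rintro _ ⟨i, rfl⟩
          exact congrFun hx i
        exact this hw
      · intro hx
        exact funext fun i => hx _ (Submodule.subset_span ⟨i, rfl⟩)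
    have h1 := LinearMap.finrank_range_add_finrank_ker T
    rw [hk, hod, hn] at h1
    rw [← LinearMap.range_eq_top]
    apply Submodule.eq_top_of_finrank_eq
    rw [Module.finrank_fin_fun]
    omega
  choose w hw using fun j : Fin l => hT (Pi.single j 1)
  have huw : ∀ i j, B (u i) (w j) = if i = j then 1 else 0 := fun i j => by
    have := congrFun (hw j) i
    rw [Pi.single_apply] at this
    exact this
  -- The basis is u in order, then v, then the vectors w dual to u in reverse order. Products among
  -- the w's, and of v with the w's, fall above the diagonal of the Gram matrix and need no
  -- correction.
  let c : Fin (2 * l + 1) → Fin (2 * l + 1) → ℂ := fun i =>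
    if h : i.val < l then u ⟨i, h⟩ else
      if h' : i.rev.val < l then w ⟨i.rev, h'⟩ else v
  have hc1 : ∀ i (h : i.val < l), c i = u ⟨i, h⟩ := fun i h => dif_pos h
  have hc2 : ∀ i (h : i.rev.val < l), c i = w ⟨i.rev, h⟩ := fun i h => by
    have h' : ¬ i.val < l := by rw [Fin.val_rev] at h; omega
    simp only [c, dif_neg h', dif_pos h]
  have hc3 : ∀ i, i.val = l → c i = v := fun i h => by
    have h' : ¬ i.val < l := by omega
    have h'' : ¬ i.rev.val < l := by rw [Fin.val_rev]; omega
    simp only [c, dif_neg h', dif_neg h'']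
  let g : Matrix (Fin (2 * l + 1)) (Fin (2 * l + 1)) ℂ := fun i j => c j i
  have hg : ∀ i j, (adj g * g) i j = B (c i.rev) (c j) := fun i j => by
    rw [hs, hB, formBilin_apply, form_eq_sum, Matrix.mul_apply]
    refine Finset.sum_congr rfl fun k _ => ?_
    exact mul_comm (c i.rev k.rev) (c j k)
  have gram : ∀ a b, a.val + b.val < 2 * l → B (c a) (c b) = 0 := by
    have half : ∀ a b, a.val + b.val < 2 * l → a.val ≤ b.val → B (c a) (c b) = 0 := by
      intro a b hab hle
      have ha : a.val < l := by omega
      rw [hc1 a ha]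
      rcases lt_trichotomy b.val l with h | h | h
      · rw [hc1 b h, hiso']
      · rw [hc3 b h, huv]
      · have hr : b.rev.val < l := by rw [Fin.val_rev]; omega
        rw [hc2 b hr, huw, if_neg]
        intro he
        have := congrArg Fin.val he
        simp only [Fin.val_rev] at this
        omega
    intro a b hab
    rcases le_total a.val b.val with h | h
    · exact half a b hab h
    · rw [hs]; exact half b a (by omega) h
  have hdiag : ∀ j, B (c j.rev) (c j) ≠ 0 := by
    have half : ∀ j : Fin (2 * l + 1), j.val < l → B (c j) (c j.rev) = 1 := fun j hj => by
      rw [hc1 j hj, hc2 j.rev (by rwa [Fin.rev_rev]), huw, if_pos]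
      simp
    intro j
    rcases lt_trichotomy j.val l with h | h | h
    · rw [hs, half j h]; exact one_ne_zero
    · have hr : j.rev = j := by ext; rw [Fin.val_rev]; omega
      rw [hr, hc3 j h]; exact hvv
    · have := half j.rev (by rw [Fin.val_rev]; omega)
      rw [Fin.rev_rev] at this
      rw [this]; exact one_ne_zero
  have hup : (adj g * g).BlockTriangular id := by
    intro i j hij
    rw [hg]
    apply gram
    have : j.val < i.val := hij
    rw [Fin.val_rev]
    omega
  refine ⟨g, fun h0 => ?_, hup, fun j k hk => ?_⟩
  · refine det_ne_zero_of_upper hup (fun i => ?_) (by rw [det_mul, h0, mul_zero])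
    rw [hg]
    exact hdiag i
  · have h : k.val < l := by omega
    change c k = u j
    rw [hc1 k h]
    congr 1
    exact Fin.ext hk

/-- Solvable subalgebras of `𝔰𝔬(2l+1)` can be conjugated into upper triangular form by an
orthogonal matrix. -/
lemma exists_orth_conj_upper {l : ℕ} (s : LieSubalgebra ℂ (so (2 * l + 1)))
    (hs : LieAlgebra.IsSolvable s) :
    ∃ g : Matrix (Fin (2 * l + 1)) (Fin (2 * l + 1)) ℂ, IsOrth g ∧
      ∀ Z ∈ s, (g⁻¹ * Z.1 * g).BlockTriangular id := by
  let f : s →ₗ⁅ℂ⁆ Module.End ℂ (Fin (2 * l + 1) → ℂ) :=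
    (lieEquivMatrix' (R := ℂ) (n := Fin (2 * l + 1))).symm.toLieHom.comp
      ((so (2 * l + 1)).incl.comp s.incl)
  let : LieRingModule s (Fin (2 * l + 1) → ℂ) := LieRingModule.compLieHom _ f
  let : LieModule ℂ s (Fin (2 * l + 1) → ℂ) := LieModule.compLieHom _ f
  obtain ⟨u, hu, hiso, hstab⟩ := exists_isotropic_flag (L := s) (B := formBilin (2 * l + 1))
    (fun Z x y => by
      rw [formBilin_apply, formBilin_apply]
      exact Z.1.2 x y)
    (fun x y => by rw [formBilin_apply, formBilin_apply, form_comm])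
    formBilin_nondegenerate l (by simp)
  obtain ⟨g, hgd, hgt, hgc⟩ := exists_triangular_gram u hu
    (fun i j => by rw [← formBilin_apply]; exact hiso i j)
  obtain ⟨h, k, hk, ho, hhd, ht⟩ := exists_polar g hgd
  have hhu := ht id hgt
  have hgu : IsUnit g.det := isUnit_iff_ne_zero.mpr hgd
  refine ⟨k, ho, fun Z hZ => ?_⟩
  -- Stability of the flag controls only the first l columns; the passage from g to k = gh⁻¹ with h
  -- upper triangular preserves this.
  have hcol : ∀ i j : Fin (2 * l + 1), j.val < l → j < i → (g⁻¹ * Z.1 * g) i j = 0 := by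
    intro i j hj hij
    have h1 : Z.1 *ᵥ u ⟨j, hj⟩ ∈ Submodule.span ℂ (u '' Set.Iic ⟨j, hj⟩) :=
      hstab ⟨Z, hZ⟩ ⟨j, hj⟩
    rw [← hgc ⟨j, hj⟩ j rfl] at h1
    have h2 : (g⁻¹ * Z.1 * g) i j = (g⁻¹ *ᵥ (Z.1 *ᵥ g.col j)) i := by
      rw [mulVec_mulVec]; rfl
    rw [h2]
    refine Submodule.span_induction (p := fun m _ => (g⁻¹ *ᵥ m) i = 0) ?_ ?_ ?_ ?_ h1
    · rintro _ ⟨a, ha, rfl⟩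
      have ha' : a.val ≤ j.val := ha
      rw [← hgc a ⟨a, by omega⟩ rfl]
      have : (g⁻¹ *ᵥ g.col ⟨a, by omega⟩) i = (g⁻¹ * g) i ⟨a, by omega⟩ := rfl
      rw [this, nonsing_inv_mul _ hgu, one_apply_ne]
      intro he
      have hlt : j.val < i.val := hij
      rw [he] at hlt
      simp only at hlt
      omega
    · simp
    · intro a b _ _ ha hb
      rw [mulVec_add, Pi.add_apply, ha, hb, add_zero]
    · intro c a _ ha
      rw [mulVec_smul, Pi.smul_apply, ha, smul_zero]
  have hkg : k⁻¹ * Z.1 * k = h * (g⁻¹ * Z.1 * g) * h⁻¹ := by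
    have hhu' : IsUnit h.det := isUnit_iff_ne_zero.mpr hhd
    have e1 : k = g * h⁻¹ := by rw [hk, mul_assoc, mul_nonsing_inv _ hhu', mul_one]
    have e2 : k⁻¹ = h * g⁻¹ := by
      rw [hk, Matrix.mul_inv_rev, ← mul_assoc, mul_nonsing_inv _ hhu', one_mul]
    rw [e2]
    nth_rw 1 [e1]
    simp only [mul_assoc]
  have hcol' : ∀ i j : Fin (2 * l + 1), j.val < l → j < i → (k⁻¹ * Z.1 * k) i j = 0 := by
    intro i j hj hij
    rw [hkg, Matrix.mul_apply]
    refine Finset.sum_eq_zero fun a _ => ?_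
    rcases lt_or_ge j a with h1 | h1
    · rw [(BlockTriangular_inv hhu) h1, mul_zero]
    · rw [Matrix.mul_apply, Finset.sum_eq_zero, zero_mul]
      intro b _
      rcases lt_or_ge b i with h2 | h2
      · rw [hhu h2, zero_mul]
      · have ha : a.val < l := lt_of_le_of_lt (Fin.le_def.mp h1) hj
        rw [hcol b a ha (lt_of_le_of_lt h1 (lt_of_lt_of_le hij h2)), mul_zero]
  -- Skewness under reflection in the antidiagonal carries an entry below the diagonal in the
  -- remaining columns to one in the first l columns.
  have hso : adj (k⁻¹ * Z.1 * k) = -(k⁻¹ * Z.1 * k) := by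
    have hki : k⁻¹ = adj k := inv_eq_left_inv ho
    rw [hki, adj_mul, adj_mul, adj_adj, (mem_so_iff _).mp Z.2]
    simp [mul_assoc]
  intro i j hij
  have hlt : j.val < i.val := hij
  by_cases hj : j.val < l
  · exact hcol' i j hj hij
  · have h1 := congrFun (congrFun hso i) j
    rw [adj_apply, Matrix.neg_apply] at h1
    rw [hcol' j.rev i.rev (by rw [Fin.val_rev]; omega) (Fin.rev_lt_rev.mpr hij)] at h1
    simpa using h1.symm

end OrthoFlag

namespace OrthoFlag

open Matrix

attribute [local instance 100] LieRing.ofAssociativeRing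

/-! ### Solvability of the upper triangular subalgebra -/

section UpperTriangular

variable {n : ℕ}

/-- The upper triangular matrices in `𝔰𝔬(n)`. -/
def upperSo (n : ℕ) : LieSubalgebra ℂ (so n) where
  carrier := {Z | Z.1.BlockTriangular id}
  zero_mem' := blockTriangular_zero
  add_mem' h h' := BlockTriangular.add h h'
  smul_mem' c Z h := by
    intro i j hij
    change c * Z.1 i j = 0
    rw [h hij, mul_zero]
  lie_mem' h h' := BlockTriangular.sub (BlockTriangular.mul h h') (BlockTriangular.mul h' h)

/-- Matrices vanishing below the `m`-th superdiagonal. -/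
def VanishesBelow (m : ℕ) (M : Matrix (Fin n) (Fin n) ℂ) : Prop :=
  ∀ i j : Fin n, j.val < i.val + m → M i j = 0

lemma VanishesBelow.mul {a b : ℕ} {M N : Matrix (Fin n) (Fin n) ℂ} (hM : VanishesBelow a M)
    (hN : VanishesBelow b N) : VanishesBelow (a + b) (M * N) := by
  intro i j hij
  rw [Matrix.mul_apply]
  refine Finset.sum_eq_zero fun k _ => ?_
  by_cases h : k.val < i.val + a
  · rw [hM i k h, zero_mul]
  · rw [hN k j (by omega), mul_zero]

lemma commutator_vanishesBelow_one {M N : Matrix (Fin n) (Fin n) ℂ} (hM : M.BlockTriangular id)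
    (hN : N.BlockTriangular id) : VanishesBelow 1 (M * N - N * M) := by
  have diag : ∀ (M N : Matrix (Fin n) (Fin n) ℂ), M.BlockTriangular id → N.BlockTriangular id →
      ∀ i, (M * N) i i = M i i * N i i := by
    intro M N hM hN i
    rw [Matrix.mul_apply, Finset.sum_eq_single i]
    · intro k _ hk
      rcases lt_or_gt_of_ne hk with h | h
      · rw [hM h, zero_mul]
      · rw [hN h, mul_zero]
    · simp
  intro i j hij
  rw [Matrix.sub_apply]
  rcases (Nat.lt_succ_iff.mp hij).lt_or_eq with h | h
  · rw [hM.mul hN (i := i) (j := j) h, hN.mul hM (i := i) (j := j) h, sub_zero]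
  · obtain rfl : j = i := Fin.ext h
    rw [diag M N hM hN, diag N M hN hM, mul_comm, sub_self]

/-- The first bracket kills the diagonal. After that the product of two matrices vanishing below the
m-th superdiagonal, m ≥ 1, vanishes below the 2m-th, and 2m ≥ m + 1. -/
lemma derivedSeries_upperSo (k : ℕ) :
    ∀ X ∈ LieAlgebra.derivedSeries ℂ (upperSo n) (k + 1), VanishesBelow (k + 1) X.1.1 := by
  have step : ∀ (m p : ℕ), (∀ X ∈ LieAlgebra.derivedSeries ℂ (upperSo n) m,
      ∀ Y ∈ LieAlgebra.derivedSeries ℂ (upperSo n) m,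
        VanishesBelow p (X.1.1 * Y.1.1 - Y.1.1 * X.1.1)) →
      ∀ X ∈ LieAlgebra.derivedSeries ℂ (upperSo n) (m + 1), VanishesBelow p X.1.1 := by
    intro m p h X hX
    rw [LieAlgebra.derivedSeries_def, LieAlgebra.derivedSeriesOfIdeal_succ,
      ← LieSubmodule.mem_toSubmodule, LieSubmodule.lieIdeal_oper_eq_linear_span] at hX
    refine Submodule.span_induction (p := fun (X : upperSo n) _ => VanishesBelow p X.1.1)
      ?_ ?_ ?_ ?_ hX
    · rintro _ ⟨⟨X, hX⟩, ⟨Y, hY⟩, rfl⟩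
      exact h X hX Y hY
    · intro i j _; rfl
    · intro a b _ _ ha hb i j hij
      change a.1.1 i j + b.1.1 i j = 0
      rw [ha i j hij, hb i j hij, add_zero]
    · intro c a _ ha i j hij
      change c * a.1.1 i j = 0
      rw [ha i j hij, mul_zero]
  induction k with
  | zero => exact step 0 1 fun X _ Y _ => commutator_vanishesBelow_one X.2 Y.2
  | succ k ih =>
    refine step (k + 1) (k + 2) fun X hX Y hY i j hij => ?_
    rw [Matrix.sub_apply, (ih X hX).mul (ih Y hY) i j (by omega),
      (ih Y hY).mul (ih X hX) i j (by omega), sub_zero]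

lemma isSolvable_upperSo : LieAlgebra.IsSolvable (upperSo n) := by
  refine LieAlgebra.IsSolvable.mk (R := ℂ) (k := n + 1) ?_
  rw [LieSubmodule.eq_bot_iff]
  intro X hX
  apply Subtype.ext
  apply Subtype.ext
  ext i j
  exact derivedSeries_upperSo n X hX i j (by omega)

end UpperTriangular

/-! ### Borel subalgebras as G/B -/

section Conjugation

variable {n : ℕ}

lemma SO.isOrth (g : SO n) : IsOrth g.1.1 := (mem_SO_iff g.1).mp g.2

lemma SO.coe_inv (g : SO n) : (g⁻¹).1.1 = adj g.1.1 := by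
  rw [← (SO.isOrth g).inv_eq]
  exact (inv_eq_right_inv (coe_mul_inv g)).symm

lemma mem_map_Ad (g : SO n) (s : LieSubalgebra ℂ (so n)) (Z : so n) :
    Z ∈ s.map (Ad g : so n →ₗ⁅ℂ⁆ so n) ↔ (Ad g).symm Z ∈ s := by
  constructor
  · rintro ⟨Y, hY, rfl⟩
    have : (Ad g).symm (Ad g Y) = Y := (Ad g).symm_apply_apply Y
    exact this.symm ▸ hY
  · intro h
    exact ⟨_, h, (Ad g).apply_symm_apply Z⟩

lemma coe_Ad_symm (g : SO n) (Z : so n) :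
    ((Ad g).symm Z).1 = (g⁻¹).1.1 * Z.1 * g.1.1 := rfl

variable {l : ℕ}

lemma IsOrth.det_sq {k : Matrix (Fin n) (Fin n) ℂ} (hk : IsOrth k) : k.det * k.det = 1 := by
  have := congrArg det hk
  rwa [det_mul, det_adj, det_one] at this

lemma IsOrth.smul {k : Matrix (Fin n) (Fin n) ℂ} (hk : IsOrth k) {c : ℂ} (hc : c * c = 1) :
    IsOrth (c • k) := by
  unfold IsOrth at *
  rw [adj_smul, smul_mul_smul_comm, hc, hk, one_smul]

/-- In odd dimension, an orthogonal matrix is up to sign an element of `SO`. -/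
def toSO (k : Matrix (Fin (2 * l + 1)) (Fin (2 * l + 1)) ℂ) (hk : IsOrth k) : SO (2 * l + 1) :=
  ⟨⟨k.det • k, by
    -- With d = det k and d² = 1, the determinant of dk is d^(2l+1) d = 1 because the dimension is
    -- odd.
    rw [det_smul, Fintype.card_fin, pow_succ, pow_mul, sq, hk.det_sq, one_pow, one_mul,
      hk.det_sq]⟩, (mem_SO_iff _).mpr (hk.smul hk.det_sq)⟩

lemma coe_toSO (k : Matrix (Fin (2 * l + 1)) (Fin (2 * l + 1)) ℂ) (hk : IsOrth k) :
    (toSO k hk).1.1 = k.det • k := rfl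

lemma toSO_mem_upperBorel {k : Matrix (Fin (2 * l + 1)) (Fin (2 * l + 1)) ℂ} (hk : IsOrth k)
    (hu : k.BlockTriangular id) : toSO k hk ∈ upperBorel (2 * l + 1) := by
  intro i j hij
  change k.det * k i j = 0
  rw [hu hij, mul_zero]

lemma exists_le_map_Ad (s : LieSubalgebra ℂ (so (2 * l + 1))) (hs : LieAlgebra.IsSolvable s) :
    ∃ g : SO (2 * l + 1), s ≤ (upperSo (2 * l + 1)).map (Ad g : so _ →ₗ⁅ℂ⁆ so _) := by
  obtain ⟨k, hk, h⟩ := exists_orth_conj_upper s hs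
  refine ⟨toSO k hk, fun Z hZ => ?_⟩
  rw [mem_map_Ad]
  change ((Ad (toSO k hk)).symm Z).1.BlockTriangular id
  have := h Z hZ
  rw [hk.inv_eq] at this
  rwa [coe_Ad_symm, SO.coe_inv, coe_toSO, adj_smul, smul_mul_assoc, smul_mul_smul_comm,
    hk.det_sq, one_smul]

lemma finrank_map_Ad (g : SO n) (s : LieSubalgebra ℂ (so n)) :
    Module.finrank ℂ (s.map (Ad g : so n →ₗ⁅ℂ⁆ so n)) = Module.finrank ℂ s :=
  LinearEquiv.finrank_map_eq (Ad g).toLinearEquiv s.toSubmodule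

lemma adj_single (a b : Fin n) :
    adj (Matrix.single a b (1 : ℂ)) = Matrix.single b.rev a.rev 1 := by
  ext i j
  simp only [adj_apply, Matrix.single_apply]
  congr 1
  rw [Fin.rev_eq_iff, Fin.rev_eq_iff, eq_iff_iff, and_comm]

/-- The standard Borel subalgebra of `𝔰𝔬(2l+1)`. -/
def stdBorel (l : ℕ) : BorelSubalgebra (so (2 * l + 1)) :=
  ⟨upperSo (2 * l + 1), isSolvable_upperSo, fun s hs hle => by
    -- A larger solvable s lies in a conjugate of the upper triangular subalgebra, so equality of
    -- dimensions leaves no room.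
    obtain ⟨g, hg⟩ := exists_le_map_Ad s hs
    have h : (upperSo (2 * l + 1)).toSubmodule =
        ((upperSo (2 * l + 1)).map (Ad g : so _ →ₗ⁅ℂ⁆ so _)).toSubmodule :=
      Submodule.eq_of_le_of_finrank_eq (hle.trans hg) (finrank_map_Ad g _).symm
    intro Z hZ
    have : Z ∈ (upperSo (2 * l + 1)).toSubmodule := by
      rw [h]; exact hg hZ
    exact this⟩

lemma coe_smul_borel (g : SO n) (b : BorelSubalgebra (so n)) :
    (g • b).1 = b.1.map (Ad g : so n →ₗ⁅ℂ⁆ so n) := rfl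

lemma exists_smul_stdBorel (b : BorelSubalgebra (so (2 * l + 1))) :
    ∃ g : SO (2 * l + 1), b = g • stdBorel l := by
  obtain ⟨g, hg⟩ := exists_le_map_Ad b.1 b.2.1
  exact ⟨g, Subtype.ext (le_antisymm hg (b.2.2 (g • stdBorel l).2.1 hg))⟩

lemma smul_stdBorel_of_mem_upperBorel {g : SO (2 * l + 1)} (hg : g ∈ upperBorel (2 * l + 1)) :
    g • stdBorel l = stdBorel l := by
  apply Subtype.ext
  have hi : g⁻¹ ∈ upperBorel (2 * l + 1) := inv_mem hg
  ext Z
  rw [coe_smul_borel, mem_map_Ad]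
  change ((g⁻¹).1.1 * Z.1 * g.1.1).BlockTriangular id ↔ Z.1.BlockTriangular id
  constructor
  · intro h
    have h' := (BlockTriangular.mul (BlockTriangular.mul hg h) hi)
    have e : g.1.1 * ((g⁻¹).1.1 * Z.1 * g.1.1) * (g⁻¹).1.1 = Z.1 := by
      calc _ = (g.1.1 * (g⁻¹).1.1) * Z.1 * (g.1.1 * (g⁻¹).1.1) := by simp only [mul_assoc]
        _ = Z.1 := by rw [coe_mul_inv, one_mul, mul_one]
    rwa [e] at h'
  · intro h
    exact BlockTriangular.mul (BlockTriangular.mul hi h) hg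

/-- The Bruhat decomposition in `SO(2l+1)`. -/
lemma exists_bruhat_SO (g : SO (2 * l + 1)) :
    ∃ (σ : Equiv.Perm (Fin (2 * l + 1))) (hσ : ∀ i, σ i.rev = (σ i).rev),
      ∃ b₁ ∈ upperBorel (2 * l + 1), ∃ b₂ ∈ upperBorel (2 * l + 1),
        g = b₁ * toSO (permMat σ) (permMat_isOrth hσ) * b₂ := by
  obtain ⟨k₁, k₂, σ, hu₁, hu₂, ho₁, ho₂, hσ, e⟩ := exists_bruhat_orth g.1.1 (SO.isOrth g)
  refine ⟨σ, hσ, toSO k₁ ho₁, toSO_mem_upperBorel _ hu₁, toSO k₂ ho₂,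
    toSO_mem_upperBorel _ hu₂, ?_⟩
  apply Subtype.ext
  apply Subtype.ext
  change g.1.1 = (k₁.det • k₁) * ((permMat σ).det • permMat σ) * (k₂.det • k₂)
  have hd : k₁.det * (permMat σ).det * k₂.det = 1 := by
    rw [← det_mul, ← det_mul, ← e]
    exact g.1.2
  rw [smul_mul_smul_comm, smul_mul_smul_comm, hd, one_smul, e]

/-- By Bruhat it suffices to treat a signed permutation matrix w. If w stabilizes the standard Borel
subalgebra, conjugation keeps each root vector for neighbouring indices upper triangular; this makes
σ⁻¹ increasing, hence trivial. -/
lemma mem_upperBorel_of_smul_stdBorel {g : SO (2 * l + 1)} (hg : g • stdBorel l = stdBorel l) :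
    g ∈ upperBorel (2 * l + 1) := by
  obtain ⟨σ, hσ, b₁, h₁, b₂, h₂, rfl⟩ := exists_bruhat_SO g
  set w := toSO (permMat σ) (permMat_isOrth hσ) with hw
  have hws : w • stdBorel l = stdBorel l := by
    rw [mul_smul, mul_smul, smul_stdBorel_of_mem_upperBorel h₂] at hg
    have h3 := congrArg (fun b => b₁⁻¹ • b) hg
    simp only [inv_smul_smul] at h3
    rw [h3, smul_stdBorel_of_mem_upperBorel (inv_mem h₁)]
  have hmono : StrictMono σ.symm := by
    rw [Fin.strictMono_iff_lt_succ]
    intro i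
    set a := i.castSucc with ha
    set b := i.succ with hb
    have hab : a.val + 1 = b.val := by simp [ha, hb]
    -- By parity a + (a + 1) ≠ 2l, so the two terms of Z below do not cancel.
    have hrev : a.rev ≠ b := fun h => by
      have := congrArg Fin.val h
      rw [Fin.val_rev] at this
      omega
    let Z : Matrix (Fin (2 * l + 1)) (Fin (2 * l + 1)) ℂ :=
      Matrix.single a b 1 - Matrix.single b.rev a.rev 1
    have hZ : Z ∈ so (2 * l + 1) := by
      rw [mem_so_iff, adj_sub, neg_sub]
      rw [adj_single, adj_single, Fin.rev_rev, Fin.rev_rev]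
    have hZu : Z.BlockTriangular id := by
      have e1 : ∀ (c d : Fin (2 * l + 1)), c < d →
          (Matrix.single c d (1 : ℂ)).BlockTriangular id := by
        intro c d hcd i j hij
        rw [Matrix.single_apply, if_neg]
        rintro ⟨rfl, rfl⟩
        exact lt_asymm hcd hij
      exact (e1 a b (Fin.lt_def.mpr (by omega))).sub
        (e1 b.rev a.rev (Fin.rev_lt_rev.mpr (Fin.lt_def.mpr (by omega))))
    have hmem : (⟨Z, hZ⟩ : so (2 * l + 1)) ∈ (w • stdBorel l).1 := by
      rw [hws]; exact hZu
    rw [coe_smul_borel, mem_map_Ad] at hmem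
    have hu : ((w⁻¹).1.1 * Z * w.1.1).BlockTriangular id := hmem
    rw [SO.coe_inv, hw, coe_toSO, adj_smul, smul_mul_assoc, smul_mul_smul_comm,
      (permMat_isOrth hσ).det_sq, one_smul] at hu
    rw [adj_permMat_of_comm hσ] at hu
    by_contra hlt
    have hne : σ.symm b ≠ σ.symm a := fun h => by
      have := congrArg Fin.val (σ.symm.injective h)
      omega
    have h0 := hu (i := σ.symm a) (j := σ.symm b) (lt_of_le_of_ne (not_lt.mp hlt) hne)
    rw [mul_permMat_apply, permMat_mul_apply] at h0
    simp only [Equiv.Perm.inv_def, Equiv.symm_symm, Equiv.apply_symm_apply] at h0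
    have hbr : b.rev ≠ a := fun h => hrev (by rw [← h, Fin.rev_rev])
    simp [Z, hbr] at h0
  have hσ1 : σ = 1 := by
    have h1 : ∀ i, i ≤ σ.symm i := fun i => hmono.le_apply
    have h2 := perm_eq_of_le (σ := 1) (τ := σ.symm) h1
    have h3 := congrArg Equiv.symm h2
    simpa [Equiv.Perm.one_def] using h3.symm
  have hwu : w ∈ upperBorel (2 * l + 1) := by
    apply toSO_mem_upperBorel
    rw [hσ1]
    have : permMat (1 : Equiv.Perm (Fin (2 * l + 1))) = 1 := by
      ext i j; rfl
    rw [this]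
    exact blockTriangular_one
  exact mul_mem (mul_mem h₁ hwu) h₂

end Conjugation

end OrthoFlag

/-! ### The action of B on the middle vector -/

namespace OrthoFlag

open Matrix

variable {l : ℕ}

/-- The middle index. -/
def mid (l : ℕ) : Fin (2 * l + 1) := ⟨l, by omega⟩

@[simp] lemma rev_mid : (mid l).rev = mid l := by
  ext; rw [Fin.val_rev]; simp only [mid]; omega

lemma rev_lt_mid_iff {i : Fin (2 * l + 1)} : i.rev < mid l ↔ mid l < i := by
  rw [Fin.rev_lt_iff, rev_mid]

lemma eq_mid_of_rev_eq {i : Fin (2 * l + 1)} (h : i.rev = i) : i = mid l := by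
  have := congrArg Fin.val h
  rw [Fin.val_rev] at this
  ext
  simp only [mid]
  omega

lemma map_mid {b : Fin (2 * l + 1) → Fin (2 * l + 1)} (hb : ∀ i, b i.rev = (b i).rev) :
    b (mid l) = mid l := by
  apply eq_mid_of_rev_eq
  rw [← hb, rev_mid]

lemma symm_rev {σ : Equiv.Perm (Fin (2 * l + 1))} (hσ : ∀ i, σ i.rev = (σ i).rev)
    (i : Fin (2 * l + 1)) : σ.symm i.rev = (σ.symm i).rev := by
  rw [Equiv.symm_apply_eq, hσ, Equiv.apply_symm_apply]

lemma middleVec_apply (i : Fin (2 * l + 1)) :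
    middleVec l i = if i = mid l then 1 else 0 := by
  rw [middleVec, Pi.single_apply]; rfl

lemma middleVec_dotProduct (x : Fin (2 * l + 1) → ℂ) : middleVec l ⬝ᵥ x = x (mid l) := by
  rw [middleVec, single_dotProduct, one_mul]; rfl

lemma middleVec_comp_rev : middleVec l ∘ Fin.rev = middleVec l := by
  ext i
  simp only [Function.comp_apply, middleVec_apply]
  congr 1
  rw [Fin.rev_eq_iff, rev_mid]

/-- Vectors in the span of the basis vectors preceding the middle one. -/
def LowSupp (a : Fin (2 * l + 1) → ℂ) : Prop := ∀ i, a i ≠ 0 → i < mid l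

lemma LowSupp.apply_mid {a : Fin (2 * l + 1) → ℂ} (ha : LowSupp a) : a (mid l) = 0 := by
  by_contra h
  exact lt_irrefl _ (ha _ h)

lemma LowSupp.dotProduct {a b : Fin (2 * l + 1) → ℂ} (ha : LowSupp a) (hb : LowSupp b) :
    (a ∘ Fin.rev) ⬝ᵥ b = 0 := by
  refine Finset.sum_eq_zero fun i _ => ?_
  by_contra h
  obtain ⟨h1, h2⟩ := mul_ne_zero_iff.mp h
  exact lt_asymm (hb i h2) (rev_lt_mid_iff.mp (ha _ h1))

lemma LowSupp.neg {a : Fin (2 * l + 1) → ℂ} (ha : LowSupp a) : LowSupp (-a) := fun i h =>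
  ha i (by simpa using h)

/-- The unipotent orthogonal matrix sending `e_0` to `e_0 + a`. -/
noncomputable def unip (a : Fin (2 * l + 1) → ℂ) : Matrix (Fin (2 * l + 1)) (Fin (2 * l + 1)) ℂ :=
  1 + vecMulVec a (middleVec l) - vecMulVec (middleVec l) (a ∘ Fin.rev)
    - (1 / 2 : ℂ) • vecMulVec a (a ∘ Fin.rev)

lemma adj_unip (a : Fin (2 * l + 1) → ℂ) : adj (unip a) = unip (-a) := by
  have hr : (-a) ∘ Fin.rev = -(a ∘ Fin.rev) := rfl
  have ha : (a ∘ Fin.rev) ∘ Fin.rev = a := by ext i; simp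
  simp only [unip, adj_sub, adj_add, adj_one, adj_smul, adj_vecMulVec, middleVec_comp_rev, hr, ha,
    neg_vecMulVec, vecMulVec_neg, neg_neg]
  abel

lemma unip_mulVec (a x : Fin (2 * l + 1) → ℂ) :
    unip a *ᵥ x = x + x (mid l) • a - ((a ∘ Fin.rev) ⬝ᵥ x) • middleVec l
      - ((1 / 2 : ℂ) * ((a ∘ Fin.rev) ⬝ᵥ x)) • a := by
  simp only [unip, sub_mulVec, add_mulVec, one_mulVec, smul_mulVec, vecMulVec_mulVec,
    middleVec_dotProduct, op_smul_eq_smul, smul_smul]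

lemma unip_mulVec_middleVec {a : Fin (2 * l + 1) → ℂ} (ha : LowSupp a) :
    unip a *ᵥ middleVec l = middleVec l + a := by
  have h : (a ∘ Fin.rev) ⬝ᵥ middleVec l = 0 := by
    rw [dotProduct_comm, middleVec_dotProduct]
    simpa using ha.apply_mid
  rw [unip_mulVec, h, middleVec_apply, if_pos rfl]
  simp

lemma unip_mulVec_lowSupp {a x : Fin (2 * l + 1) → ℂ} (ha : LowSupp a) (hx : LowSupp x) :
    unip a *ᵥ x = x := by
  rw [unip_mulVec, ha.dotProduct hx, hx.apply_mid]
  simp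

/-- With N = a e_0ᵀ - e_0 (a ∘ rev)ᵀ one has N* = -N, and for low a also N² = -a (a ∘ rev)ᵀ and N³ =
0. So `unip a` is exp N, and its adjoint is exp(-N). -/
lemma isOrth_unip {a : Fin (2 * l + 1) → ℂ} (ha : LowSupp a) : IsOrth (unip a) := by
  rw [IsOrth, adj_unip]
  have hr : (-a) ∘ Fin.rev = -(a ∘ Fin.rev) := rfl
  have h1 : middleVec l ⬝ᵥ a = 0 := by rw [middleVec_dotProduct, ha.apply_mid]
  have h2 : middleVec l ⬝ᵥ middleVec l = 1 := by
    rw [middleVec_dotProduct, middleVec_apply, if_pos rfl]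
  have h3 : (a ∘ Fin.rev) ⬝ᵥ middleVec l = 0 := by
    rw [dotProduct_comm, middleVec_dotProduct]
    simpa using ha.apply_mid
  have h4 := ha.dotProduct ha
  simp only [unip, hr, neg_vecMulVec, vecMulVec_neg, mul_add, add_mul, mul_sub, sub_mul,
    neg_mul, smul_mul_assoc, mul_smul_comm, vecMulVec_mul_vecMulVec, h1, h2, h3, h4, one_mul,
    mul_one, zero_smul, one_smul, vecMulVec_zero]
  module

/-- Since `b` commutes with the reversal it fixes the middle. The off-identity entries join
positions with b below, at and above the middle, always in increasing order from row to column. -/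
lemma unip_blockTriangular {a : Fin (2 * l + 1) → ℂ} {b : Fin (2 * l + 1) → Fin (2 * l + 1)}
    (hb : ∀ i, b i.rev = (b i).rev) (ha : ∀ i, a i ≠ 0 → b i < mid l) :
    (unip a).BlockTriangular b := by
  have hbm := map_mid hb
  have hr : ∀ i, a i.rev ≠ 0 → mid l < b i := fun i h => by
    have := ha _ h
    rwa [hb, rev_lt_mid_iff] at this
  have h1 : (vecMulVec a (middleVec l)).BlockTriangular b := by
    intro i j hij
    rw [vecMulVec_apply, middleVec_apply]
    by_contra h
    obtain ⟨h1, h2⟩ := mul_ne_zero_iff.mp h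
    have hj : j = mid l := by by_contra hj; exact h2 (if_neg hj)
    rw [hj, hbm] at hij
    exact lt_asymm hij (ha i h1)
  have h2 : (vecMulVec (middleVec l) (a ∘ Fin.rev)).BlockTriangular b := by
    intro i j hij
    rw [vecMulVec_apply, middleVec_apply]
    by_contra h
    obtain ⟨h1, h2⟩ := mul_ne_zero_iff.mp h
    have hi : i = mid l := by by_contra hi; exact h1 (if_neg hi)
    rw [hi, hbm] at hij
    exact lt_asymm hij (hr j h2)
  have h3 : (vecMulVec a (a ∘ Fin.rev)).BlockTriangular b := by
    intro i j hij
    rw [vecMulVec_apply]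
    by_contra h
    obtain ⟨h1, h2⟩ := mul_ne_zero_iff.mp h
    exact lt_asymm hij ((ha i h1).trans (hr j h2))
  refine ((blockTriangular_one.add h1).sub h2).sub ?_
  intro i j hij
  rw [Matrix.smul_apply, h3 hij, smul_zero]

lemma IsOrth.diag_mul_diag_rev {n : ℕ} {k : Matrix (Fin n) (Fin n) ℂ} (hk : IsOrth k)
    (hu : k.BlockTriangular id) (i : Fin n) : k i.rev i.rev * k i i = 1 := by
  have h := congrFun (congrFun hk i) i
  rw [Matrix.mul_apply, Finset.sum_eq_single i, one_apply_eq] at h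
  · exact h
  · intro j _ hj
    rcases lt_or_gt_of_ne hj with h' | h'
    · rw [adj_apply, hu (i := j.rev) (j := i.rev) (Fin.rev_lt_rev.mpr h'), zero_mul]
    · rw [hu (i := j) (j := i) h', mul_zero]
  · simp

/-- The diagonal entries at i and rev i are mutually inverse, so only the middle one survives in the
product. -/
lemma IsOrth.det_eq_one {k : Matrix (Fin (2 * l + 1)) (Fin (2 * l + 1)) ℂ} (hk : IsOrth k)
    (hu : k.BlockTriangular id) (hm : k (mid l) (mid l) = 1) : k.det = 1 := by
  rw [det_of_isUpperTriangular hu]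
  refine Finset.prod_involution (fun i _ => i.rev) (fun i _ => ?_) (fun i _ hi he => ?_)
    (fun _ _ => Finset.mem_univ _) (fun i _ => Fin.rev_rev i)
  · rw [mul_comm]; exact hk.diag_mul_diag_rev hu i
  · rw [eq_mid_of_rev_eq he] at hi
    exact hi hm

/-- The middle entry is ±1. If it were -1, then -g would have determinant 1, whereas det(-g) = -det
g = -1 in odd dimension. -/
lemma apply_mid_mid_of_mem_upperBorel {g : SO (2 * l + 1)} (hg : g ∈ upperBorel (2 * l + 1)) :
    g.1.1 (mid l) (mid l) = 1 := by
  have h := (SO.isOrth g).diag_mul_diag_rev hg (mid l)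
  rw [rev_mid, mul_self_eq_one_iff] at h
  rcases h with h | h
  · exact h
  · have ho : IsOrth (-g.1.1) := by
      rw [IsOrth, adj_neg, neg_mul_neg]; exact SO.isOrth g
    have := ho.det_eq_one (BlockTriangular.neg hg) (by rw [Matrix.neg_apply, h, neg_neg])
    have hdet : g.1.1.det = 1 := g.1.2
    rw [det_neg, Fintype.card_fin, hdet, pow_succ, pow_mul] at this
    norm_num at this

lemma mulVec_middleVec_of_mem_upperBorel {g : SO (2 * l + 1)}
    (hg : g ∈ upperBorel (2 * l + 1)) :
    ∃ a, LowSupp a ∧ g.1.1 *ᵥ middleVec l = middleVec l + a := by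
  have hcol : ∀ i, (g.1.1 *ᵥ middleVec l) i = g.1.1 i (mid l) := fun i => by
    rw [mulVec, dotProduct_comm, middleVec_dotProduct]
  refine ⟨g.1.1 *ᵥ middleVec l - middleVec l, fun i hi => ?_, by abel⟩
  rw [Pi.sub_apply, hcol, middleVec_apply] at hi
  by_contra hlt
  apply hi
  rcases (not_lt.mp hlt).eq_or_lt with h | h
  · rw [← h, apply_mid_mid_of_mem_upperBorel hg, if_pos rfl, sub_self]
  · rw [hg (i := i) (j := mid l) h, if_neg h.ne', sub_zero]

lemma unip_mid_mid {a : Fin (2 * l + 1) → ℂ} (ha : LowSupp a) :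
    unip a (mid l) (mid l) = 1 := by
  have h := congrFun (unip_mulVec_middleVec ha) (mid l)
  rw [mulVec, dotProduct_comm, middleVec_dotProduct, Pi.add_apply, ha.apply_mid,
    middleVec_apply, if_pos rfl, add_zero] at h
  exact h

/-- `unip a` as an element of `SO(2l+1)`. -/
noncomputable def unipSO (a : Fin (2 * l + 1) → ℂ) (ha : LowSupp a) : SO (2 * l + 1) :=
  ⟨⟨unip a, (isOrth_unip ha).det_eq_one (unip_blockTriangular (b := id) (fun _ => rfl) ha)
    (unip_mid_mid ha)⟩, (mem_SO_iff _).mpr (isOrth_unip ha)⟩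

lemma coe_unipSO (a : Fin (2 * l + 1) → ℂ) (ha : LowSupp a) : (unipSO a ha).1.1 = unip a := rfl

lemma unipSO_mem_upperBorel (a : Fin (2 * l + 1) → ℂ) (ha : LowSupp a) :
    unipSO a ha ∈ upperBorel (2 * l + 1) :=
  unip_blockTriangular (b := id) (fun _ => rfl) ha

end OrthoFlag

/-! ### Classification of the orbits by signed permutations and antichains -/

namespace OrthoFlag

open Matrix

variable {l : ℕ}

/-- Combinatorial data parametrizing the orbits: a signed permutation `σ` and an antichain `A`
among the positive indices which `σ⁻¹` makes negative. -/
def IsDatum (σ : Equiv.Perm (Fin (2 * l + 1))) (A : Finset (Fin (2 * l + 1))) : Prop :=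
  (∀ i, σ i.rev = (σ i).rev) ∧ (∀ i ∈ A, i < mid l ∧ mid l < σ.symm i) ∧
    ∀ i ∈ A, ∀ j ∈ A, i < j → σ.symm j < σ.symm i

/-- The indicator vector of a set of indices. -/
noncomputable def ind (A : Finset (Fin (2 * l + 1))) : Fin (2 * l + 1) → ℂ :=
  fun i => if i ∈ A then 1 else 0

lemma IsDatum.lowSupp {σ : Equiv.Perm (Fin (2 * l + 1))} {A : Finset (Fin (2 * l + 1))}
    (h : IsDatum σ A) : LowSupp (ind A) := fun i hi => by
  by_contra hlt
  exact hi (if_neg fun hA => hlt (h.2.1 i hA).1)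

section LeviFactor

variable {n : ℕ}

lemma adj_nonsing_inv (M : Matrix (Fin n) (Fin n) ℂ) (hM : M.det ≠ 0) :
    adj M⁻¹ = (adj M)⁻¹ := by
  refine (inv_eq_left_inv ?_).symm
  rw [← adj_mul, mul_nonsing_inv _ (isUnit_iff_ne_zero.mpr hM), adj_one]

/-- This embeds GL(l) in the orthogonal group: for M acting on the low coordinates only, M(M*)⁻¹
acts by M there and by the inverse adjoint on the high ones. -/
lemma isOrth_mul_inv_adj {M : Matrix (Fin n) (Fin n) ℂ} (hM : M.det ≠ 0)
    (hc : M * adj M = adj M * M) : IsOrth (M * (adj M)⁻¹) := by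
  have hu : IsUnit M.det := isUnit_iff_ne_zero.mpr hM
  have hu' : IsUnit (adj M).det := by rwa [det_adj]
  rw [IsOrth, adj_mul, adj_nonsing_inv _ (by rwa [det_adj]), adj_adj]
  calc M⁻¹ * adj M * (M * (adj M)⁻¹) = M⁻¹ * (adj M * M) * (adj M)⁻¹ := by
        simp only [mul_assoc]
    _ = (M⁻¹ * M) * (adj M * (adj M)⁻¹) := by rw [← hc]; simp only [mul_assoc]
    _ = 1 := by rw [nonsing_inv_mul _ hu, mul_nonsing_inv _ hu', one_mul]

lemma det_mul_inv_adj {M : Matrix (Fin n) (Fin n) ℂ} (hM : M.det ≠ 0) :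
    (M * (adj M)⁻¹).det = 1 := by
  rw [det_mul, det_nonsing_inv, det_adj, Ring.inverse_eq_inv', mul_inv_cancel₀ hM]

end LeviFactor

/-- A vector in `e_0 + ⟨e_i : i ∈ S⟩` can be moved to the sum of `e_0` and the basis vectors of the
maximal elements of `S` by a block diagonal orthogonal matrix preserving the flags. -/
lemma exists_levi {σ : Equiv.Perm (Fin (2 * l + 1))} (hσ : ∀ i, σ i.rev = (σ i).rev)
    {a : Fin (2 * l + 1) → ℂ} (ha : LowSupp a) (ha' : ∀ i, a i ≠ 0 → mid l < σ.symm i) :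
    ∃ A, IsDatum σ A ∧ ∃ h : Matrix (Fin (2 * l + 1)) (Fin (2 * l + 1)) ℂ, IsOrth h ∧ h.det = 1 ∧
      h.BlockTriangular id ∧ h.BlockTriangular σ.symm ∧
      h *ᵥ (middleVec l + ind A) = middleVec l + a := by
  classical
  let le : Fin (2 * l + 1) → Fin (2 * l + 1) → Prop := fun i j => i ≤ j ∧ σ.symm i ≤ σ.symm j
  let S := Finset.univ.filter fun i => a i ≠ 0
  have hS : ∀ i, i ∈ S ↔ a i ≠ 0 := fun i => by simp [S]
  let A := S.filter fun i => ∀ j ∈ S, le i j → j = i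
  have hAS : ∀ i ∈ A, i ∈ S := fun i hi => (Finset.mem_filter.mp hi).1
  have hmax : ∀ i ∈ A, ∀ j ∈ S, le i j → j = i := fun i hi => (Finset.mem_filter.mp hi).2
  have hex : ∀ i, ∃ j, i ∈ S → j ∈ A ∧ le i j := by
    intro i
    by_cases hi : i ∈ S
    · let p : Fin (2 * l + 1) → Fin (2 * l + 1) × Fin (2 * l + 1) := fun i => (i, σ.symm i)
      obtain ⟨q, hq, hqm⟩ := (S.image p).exists_le_maximal (Finset.mem_image_of_mem p hi)
      obtain ⟨j, hj, rfl⟩ := Finset.mem_image.mp hqm.1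
      refine ⟨j, fun _ => ⟨Finset.mem_filter.mpr ⟨hj, fun k hk hjk => ?_⟩, hq⟩⟩
      exact le_antisymm (hqm.2 (Finset.mem_image_of_mem p hk) hjk).1 hjk.1
    · exact ⟨i, fun h => absurd h hi⟩
  choose f hf using hex
  have hfA : ∀ i ∈ A, f i = i := fun i hi =>
    hmax i hi _ (hAS _ (hf i (hAS i hi)).1) (hf i (hAS i hi)).2
  have hSm : ∀ i ∈ S, i < mid l := fun i hi => ha i ((hS i).mp hi)
  have hD : IsDatum σ A := by
    refine ⟨hσ, fun i hi => ⟨hSm i (hAS i hi), ha' i ((hS i).mp (hAS i hi))⟩,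
      fun i hi j hj hij => ?_⟩
    by_contra hlt
    exact hij.ne' (hmax i hi j (hAS j hj) ⟨hij.le, not_lt.mp hlt⟩)
  -- `f` sends each i ∈ S to a maximal element above it. For j ∈ A, 1 + D sends e_j to the sum of
  -- a_i e_i over the fibre of f at j; it is triangular for both orders because i lies below f i in
  -- both.
  let D : Matrix (Fin (2 * l + 1)) (Fin (2 * l + 1)) ℂ := fun i j =>
    if j ∈ A ∧ i ∈ S ∧ f i = j then a i - (if i = j then 1 else 0) else 0
  have hDne : ∀ i j, D i j ≠ 0 → j ∈ A ∧ i ∈ S ∧ f i = j := fun i j h => by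
    by_contra h'
    exact h (if_neg h')
  have hDS : ∀ i j, D i j ≠ 0 → i < mid l ∧ j < mid l := fun i j h =>
    ⟨hSm i (hDne i j h).2.1, hSm j (hAS j (hDne i j h).1)⟩
  have hM1 : ∀ b : Fin (2 * l + 1) → Fin (2 * l + 1), (∀ i j, le i j → b i ≤ b j) →
      (1 + D).BlockTriangular b := by
    intro b hb
    refine blockTriangular_one.add fun i j hij => ?_
    by_contra h
    obtain ⟨-, h2, h3⟩ := hDne i j h
    exact absurd (hb _ _ (hf i h2).2) (not_le.mpr (h3 ▸ hij))
  have hMu := hM1 id fun i j h => h.1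
  have hMσ := hM1 σ.symm fun i j h => h.2
  have hdet : (1 + D).det ≠ 0 := by
    refine det_ne_zero_of_upper hMu fun i => ?_
    rw [Matrix.add_apply, one_apply_eq]
    by_cases h : D i i = 0
    · rw [h, add_zero]; exact one_ne_zero
    · have h' := hDne i i h
      have : D i i = a i - 1 := by simp only [D, if_pos h', if_true]
      rw [this, add_sub_cancel]
      exact (hS i).mp h'.2.1
  have hDD : D * adj D = 0 := by
    ext i k
    rw [Matrix.mul_apply, Matrix.zero_apply]
    refine Finset.sum_eq_zero fun j _ => ?_
    by_contra h
    obtain ⟨h1, h2⟩ := mul_ne_zero_iff.mp h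
    exact lt_asymm (hDS i j h1).2 (rev_lt_mid_iff.mp (hDS _ _ h2).2)
  have hDD' : adj D * D = 0 := by
    ext i k
    rw [Matrix.mul_apply, Matrix.zero_apply]
    refine Finset.sum_eq_zero fun j _ => ?_
    by_contra h
    obtain ⟨h1, h2⟩ := mul_ne_zero_iff.mp h
    exact lt_asymm (hDS j k h2).1 (rev_lt_mid_iff.mp (hDS _ _ h1).1)
  have hcomm : (1 + D) * adj (1 + D) = adj (1 + D) * (1 + D) := by
    rw [adj_add, adj_one]
    simp only [mul_add, add_mul, mul_one, one_mul, hDD, hDD']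
    abel
  set M := 1 + D with hM
  have hv : ∀ j, (middleVec l + ind A) j ≠ 0 → j ≤ mid l := fun j hj => by
    by_contra hlt
    apply hj
    rw [Pi.add_apply, middleVec_apply, if_neg (not_le.mp hlt).ne', zero_add]
    exact if_neg fun hA => hlt (hSm j (hAS j hA)).le
  have hMv : M *ᵥ (middleVec l + ind A) = middleVec l + a := by
    have hDv : ∀ i, (D *ᵥ (middleVec l + ind A)) i =
        if i ∈ S then a i - (if i ∈ A then 1 else 0) else 0 := by
      intro i
      by_cases hi : i ∈ S
      · rw [if_pos hi, mulVec, dotProduct, Finset.sum_eq_single (f i)]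
        · have hfi := (hf i hi).1
          have h1 : (middleVec l + ind A) (f i) = 1 := by
            rw [Pi.add_apply, middleVec_apply, if_neg (hSm _ (hAS _ hfi)).ne, zero_add]
            exact if_pos hfi
          have h2 : D i (f i) = a i - (if i = f i then 1 else 0) := if_pos ⟨hfi, hi, rfl⟩
          rw [h1, h2, mul_one]
          congr 2
          rw [eq_iff_iff]
          exact ⟨fun h => h ▸ hfi, fun h => (hfA i h).symm⟩
        · intro j _ hj
          have : D i j = 0 := if_neg fun h => hj h.2.2.symm
          rw [this, zero_mul]
        · simp
      · rw [if_neg hi, mulVec, dotProduct]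
        refine Finset.sum_eq_zero fun j _ => ?_
        have : D i j = 0 := if_neg fun h => hi h.2.1
        rw [this, zero_mul]
    ext i
    rw [hM, add_mulVec, one_mulVec, Pi.add_apply, Pi.add_apply, Pi.add_apply, hDv, ind]
    by_cases hi : i ∈ S
    · rw [if_pos hi]; ring
    · have h1 : i ∉ A := fun h => hi (hAS i h)
      have h2 : a i = 0 := by
        by_contra h
        exact hi ((hS i).mpr h)
      rw [if_neg hi, if_neg h1, h2, add_zero]
  -- The adjoint of D reads only coordinates past the middle, where this vector vanishes.
  have hMadj : adj M *ᵥ (middleVec l + ind A) = middleVec l + ind A := by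
    rw [hM, adj_add, adj_one, add_mulVec, one_mulVec]
    convert! add_zero _ using 2
    ext i
    rw [mulVec, dotProduct, Pi.zero_apply]
    refine Finset.sum_eq_zero fun j _ => ?_
    by_contra h
    obtain ⟨h1, h2⟩ := mul_ne_zero_iff.mp h
    exact absurd (hv j h2) (not_le.mpr (rev_lt_mid_iff.mp (hDS _ _ h1).1))
  have hu' : IsUnit (adj M).det := by rw [det_adj]; exact isUnit_iff_ne_zero.mpr hdet
  refine ⟨A, hD, M * (adj M)⁻¹, isOrth_mul_inv_adj hdet hcomm, det_mul_inv_adj hdet,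
    hMu.mul (BlockTriangular_inv (BlockTriangular_adj (b := id) (fun _ => rfl) hMu)),
    hMσ.mul (BlockTriangular_inv (BlockTriangular_adj (b := σ.symm) (symm_rev hσ) hMσ)), ?_⟩
  rw [← mulVec_mulVec, ← hMv]
  congr 1
  nth_rw 1 [← hMadj]
  rw [mulVec_mulVec, nonsing_inv_mul _ hu', one_mulVec]

/-- Normal form of a vector in `e_0 + ⟨e_i : i < l⟩` under the stabilizer of two flags. -/
lemma exists_normal_form {σ : Equiv.Perm (Fin (2 * l + 1))} (hσ : ∀ i, σ i.rev = (σ i).rev)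
    {a : Fin (2 * l + 1) → ℂ} (ha : LowSupp a) :
    ∃ A, IsDatum σ A ∧ ∃ h : SO (2 * l + 1), h ∈ upperBorel (2 * l + 1) ∧
      h.1.1.BlockTriangular σ.symm ∧ h.1.1 *ᵥ (middleVec l + ind A) = middleVec l + a := by
  -- The part a₂ is the one reachable by a unipotent element triangular for both orders; the part a₁
  -- is left to the block diagonal matrices.
  let a₁ : Fin (2 * l + 1) → ℂ := fun i => if mid l < σ.symm i then a i else 0
  let a₂ : Fin (2 * l + 1) → ℂ := fun i => if mid l < σ.symm i then 0 else a i
  have h₁ : ∀ i, a₁ i ≠ 0 → a i ≠ 0 ∧ mid l < σ.symm i := fun i hi => by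
    by_cases h : mid l < σ.symm i
    · exact ⟨by simpa [a₁, h] using hi, h⟩
    · exact absurd (if_neg h) hi
  have h₂ : ∀ i, a₂ i ≠ 0 → a i ≠ 0 ∧ σ.symm i < mid l := fun i hi => by
    by_cases h : mid l < σ.symm i
    · exact absurd (if_pos h) hi
    · have hai : a i ≠ 0 := by simpa [a₂, h] using hi
      refine ⟨hai, lt_of_le_of_ne (not_lt.mp h) fun he => ?_⟩
      rw [Equiv.symm_apply_eq, map_mid hσ] at he
      exact (ha i hai).ne he
  have hl₁ : LowSupp a₁ := fun i hi => ha i (h₁ i hi).1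
  have hl₂ : LowSupp a₂ := fun i hi => ha i (h₂ i hi).1
  obtain ⟨A, hA, h, ho, hdet, hu, hsu, hv⟩ := exists_levi hσ hl₁ fun i hi => (h₁ i hi).2
  let h' : SO (2 * l + 1) := ⟨⟨h, hdet⟩, (mem_SO_iff _).mpr ho⟩
  refine ⟨A, hA, unipSO a₂ hl₂ * h', mul_mem (unipSO_mem_upperBorel _ _) hu,
    BlockTriangular.mul (unip_blockTriangular (symm_rev hσ) fun i hi => (h₂ i hi).2) hsu, ?_⟩
  change (unip a₂ * h) *ᵥ _ = _
  rw [← mulVec_mulVec, hv, mulVec_add, unip_mulVec_middleVec hl₂, unip_mulVec_lowSupp hl₂ hl₁,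
    add_assoc]
  congr 1
  ext i
  by_cases h : mid l < σ.symm i <;> simp [a₁, a₂, h]

/-- The representative of the orbit attached to a datum. -/
noncomputable def datumRep {σ : Equiv.Perm (Fin (2 * l + 1))} {A : Finset (Fin (2 * l + 1))}
    (h : IsDatum σ A) : SO (2 * l + 1) :=
  unipSO (-ind A) h.lowSupp.neg * toSO (permMat σ) (permMat_isOrth h.1)

lemma unipSO_neg_inv_mulVec {a : Fin (2 * l + 1) → ℂ} (ha : LowSupp a) :
    ((unipSO (-a) ha.neg)⁻¹).1.1 *ᵥ middleVec l = middleVec l + a := by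
  rw [SO.coe_inv, coe_unipSO, adj_unip, neg_neg, unip_mulVec_middleVec ha]

lemma coe_mul (g h : SO (2 * l + 1)) : (g * h).1.1 = g.1.1 * h.1.1 := rfl

lemma inv_mulVec_of_mulVec_eq {g : SO (2 * l + 1)} {v w : Fin (2 * l + 1) → ℂ}
    (h : g.1.1 *ᵥ v = w) : (g⁻¹).1.1 *ᵥ w = v := by
  rw [← h, mulVec_mulVec, coe_inv_mul, one_mulVec]

lemma conj_toSO_permMat_mem_upperBorel {σ : Equiv.Perm (Fin (2 * l + 1))}
    (hσ : ∀ i, σ i.rev = (σ i).rev) {h : SO (2 * l + 1)} (hh : h.1.1.BlockTriangular σ.symm) :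
    (toSO (permMat σ) (permMat_isOrth hσ))⁻¹ * h * toSO (permMat σ) (permMat_isOrth hσ) ∈
      upperBorel (2 * l + 1) := by
  change (((toSO (permMat σ) (permMat_isOrth hσ))⁻¹ * h *
    toSO (permMat σ) (permMat_isOrth hσ)).1.1).BlockTriangular id
  rw [coe_mul, coe_mul, SO.coe_inv, coe_toSO, adj_smul, smul_mul_assoc, smul_mul_smul_comm,
    (permMat_isOrth hσ).det_sq, one_smul, adj_permMat_of_comm hσ]
  intro i j hij
  rw [mul_permMat_apply, permMat_mul_apply]
  apply hh
  simpa [Equiv.Perm.inv_def] using hij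

/-- Write g = b₁wb₂ and b₁⁻¹e_0 = e_0 + a, and let h carry the normal form e_0 + 1_A to e_0 + a. If
u⁻¹e_0 = e_0 + 1_A, then g = (b₁hu⁻¹)(uw)(w⁻¹h⁻¹w b₂), where the first factor fixes e_0 and the last
lies in B. -/
lemma exists_eq_mul_datumRep_mul (g : SO (2 * l + 1)) :
    ∃ σ A, ∃ h : IsDatum (l := l) σ A, ∃ k ∈ borelSOEven l, ∃ b ∈ upperBorel (2 * l + 1),
      g = k * datumRep h * b := by
  obtain ⟨σ, hσ, b₁, hb₁, b₂, hb₂, e⟩ := exists_bruhat_SO g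
  obtain ⟨a, ha, hva⟩ := mulVec_middleVec_of_mem_upperBorel (inv_mem hb₁)
  obtain ⟨A, hA, h, hu, hs, hv⟩ := exists_normal_form hσ ha
  set w := toSO (permMat σ) (permMat_isOrth hσ) with hw
  set u := unipSO (-ind A) hA.lowSupp.neg with hu'
  have hub : u ∈ upperBorel (2 * l + 1) := unipSO_mem_upperBorel _ _
  have hk : b₁ * h * u⁻¹ ∈ upperBorel (2 * l + 1) := mul_mem (mul_mem hb₁ hu) (inv_mem hub)
  refine ⟨σ, A, hA, b₁ * h * u⁻¹, ⟨?_, hk⟩,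
    w⁻¹ * h⁻¹ * w * b₂, mul_mem (conj_toSO_permMat_mem_upperBorel hσ ?_) hb₂, ?_⟩
  · change (b₁ * h * u⁻¹).1.1 *ᵥ middleVec l = middleVec l
    rw [coe_mul, coe_mul, ← mulVec_mulVec, unipSO_neg_inv_mulVec hA.lowSupp, ← mulVec_mulVec, hv]
    have := inv_mulVec_of_mulVec_eq hva
    rwa [inv_inv] at this
  · rw [SO.coe_inv]
    exact BlockTriangular_adj (b := σ.symm) (symm_rev hσ) hs
  · rw [e, datumRep, ← hu', ← hw]
    group

/-- Coordinate i of the image is 1, so some entry h i j meets the support of the source; both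
triangularities bound i by j. The middle index is excluded since σ⁻¹ fixes it while σ⁻¹i lies beyond
it. -/
lemma exists_le_of_mulVec_eq {σ : Equiv.Perm (Fin (2 * l + 1))} {A A' : Finset (Fin (2 * l + 1))}
    (hA' : IsDatum σ A') {h : Matrix (Fin (2 * l + 1)) (Fin (2 * l + 1)) ℂ}
    (hu : h.BlockTriangular id) (hs : h.BlockTriangular σ.symm)
    (hv : h *ᵥ (middleVec l + ind A) = middleVec l + ind A') :
    ∀ i ∈ A', ∃ j ∈ A, i ≤ j ∧ σ.symm i ≤ σ.symm j := by
  intro i hi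
  have h1 := congrFun hv i
  have h2 : (middleVec l + ind A') i = 1 := by
    rw [Pi.add_apply, middleVec_apply, if_neg (hA'.2.1 i hi).1.ne, zero_add]
    exact if_pos hi
  have h3 : ∑ j, h i j * (middleVec l + ind A) j ≠ 0 := by
    change (h *ᵥ (middleVec l + ind A)) i ≠ 0
    rw [h1, h2]
    exact one_ne_zero
  obtain ⟨j, -, hj⟩ := Finset.exists_ne_zero_of_sum_ne_zero h3
  obtain ⟨hij, hvj⟩ := mul_ne_zero_iff.mp hj
  have hle : i ≤ j := by
    by_contra hlt
    exact hij (hu (not_le.mp hlt))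
  have hle' : σ.symm i ≤ σ.symm j := by
    by_contra hlt
    exact hij (hs (not_le.mp hlt))
  refine ⟨j, ?_, hle, hle'⟩
  by_contra hjA
  apply hvj
  have hjm : j ≠ mid l := by
    rintro rfl
    rw [map_mid (symm_rev hA'.1)] at hle'
    exact absurd (hA'.2.1 i hi).2 (not_lt.mpr hle')
  rw [Pi.add_apply, middleVec_apply, if_neg hjm, zero_add]
  exact if_neg hjA

/-- Going up from A' to A and back stays in the antichain A', so each step is an equality. -/
lemma subset_of_mutual_le {σ : Equiv.Perm (Fin (2 * l + 1))} {A A' : Finset (Fin (2 * l + 1))}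
    (hA' : IsDatum σ A') (h : ∀ i ∈ A', ∃ j ∈ A, i ≤ j ∧ σ.symm i ≤ σ.symm j)
    (h' : ∀ i ∈ A, ∃ j ∈ A', i ≤ j ∧ σ.symm i ≤ σ.symm j) : A' ⊆ A := by
  intro i hi
  obtain ⟨j, hj, h1, h2⟩ := h i hi
  obtain ⟨k, hk, h3, h4⟩ := h' j hj
  rcases (h1.trans h3).eq_or_lt with e | hlt
  · obtain rfl : i = j := le_antisymm h1 (e ▸ h3)
    exact hj
  · exact absurd (hA'.2.2 i hi k hk hlt) (not_lt.mpr (h2.trans h4))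

/-- The element y = u'⁻¹ku of B satisfies yw = w'b, so Bruhat uniqueness gives σ = σ'. Then y and
y⁻¹ are triangular for both orders and exchange e_0 + 1_A and e_0 + 1_A', so the two antichains
dominate each other. -/
lemma datum_eq_of_mul_datumRep_eq {σ σ' : Equiv.Perm (Fin (2 * l + 1))}
    {A A' : Finset (Fin (2 * l + 1))} (h : IsDatum σ A) (h' : IsDatum σ' A')
    {k b : SO (2 * l + 1)} (hk : k ∈ borelSOEven l) (hb : b ∈ upperBorel (2 * l + 1))
    (e : k * datumRep h = datumRep h' * b) : σ = σ' ∧ A = A' := by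
  set u := unipSO (-ind A) h.lowSupp.neg with hu
  set u' := unipSO (-ind A') h'.lowSupp.neg with hu'
  have hub : u ∈ upperBorel (2 * l + 1) := unipSO_mem_upperBorel _ _
  have hub' : u' ∈ upperBorel (2 * l + 1) := unipSO_mem_upperBorel _ _
  set y := u'⁻¹ * k * u with hy
  have hyb : y ∈ upperBorel (2 * l + 1) := mul_mem (mul_mem (inv_mem hub') hk.2) hub
  have e1 : y * toSO (permMat σ) (permMat_isOrth h.1) =
      toSO (permMat σ') (permMat_isOrth h'.1) * b := by
    rw [datumRep, datumRep, ← hu, ← hu', mul_assoc u', ← inv_mul_eq_iff_eq_mul] at e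
    rw [← e, hy]
    group
  have e2 : ((permMat σ).det • y.1.1) * permMat σ =
      permMat σ' * ((permMat σ').det • b.1.1) := by
    have := congrArg (fun g : SO (2 * l + 1) => g.1.1) e1
    simp only [coe_mul, coe_toSO, mul_smul_comm, smul_mul_assoc] at this ⊢
    exact this
  have smul_upper : ∀ (c : ℂ) (g : SO (2 * l + 1)), g ∈ upperBorel (2 * l + 1) →
      (c • g.1.1).BlockTriangular id := fun c g hg i j hij => by
    rw [Matrix.smul_apply, hg hij, smul_zero]
  have hσ : σ = σ' := by
    refine bruhat_unique (smul_upper _ y hyb) (smul_upper _ b hb) ?_ e2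
    rw [det_smul]
    exact mul_ne_zero (pow_ne_zero _ (permMat_isOrth h'.1).det_ne_zero) (SO.isOrth b).det_ne_zero
  subst hσ
  refine ⟨rfl, ?_⟩
  have hys : y.1.1.BlockTriangular σ.symm := by
    intro i j hij
    have h3 := congrFun (congrFun e2 i) (σ.symm j)
    rw [mul_permMat_apply, permMat_mul_apply, Equiv.apply_symm_apply, Matrix.smul_apply,
      Matrix.smul_apply, hb hij, smul_zero, smul_eq_mul] at h3
    exact (mul_eq_zero.mp h3).resolve_left (permMat_isOrth h.1).det_ne_zero
  have hyv : y.1.1 *ᵥ (middleVec l + ind A) = middleVec l + ind A' := by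
    have h1 : u.1.1 *ᵥ (middleVec l + ind A) = middleVec l := by
      have := inv_mulVec_of_mulVec_eq (unipSO_neg_inv_mulVec h.lowSupp)
      rwa [inv_inv] at this
    rw [hy, coe_mul, coe_mul, ← mulVec_mulVec, h1, ← mulVec_mulVec,
      show k.1.1 *ᵥ middleVec l = middleVec l from hk.1, unipSO_neg_inv_mulVec h'.lowSupp]
  have hys' : (y⁻¹).1.1.BlockTriangular σ.symm := by
    rw [SO.coe_inv]
    exact BlockTriangular_adj (b := σ.symm) (symm_rev h.1) hys
  have l1 := exists_le_of_mulVec_eq h' hyb hys hyv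
  have l2 := exists_le_of_mulVec_eq h (inv_mem hyb) hys' (inv_mulVec_of_mulVec_eq hyv)
  exact (subset_of_mutual_le h l2 l1).antisymm (subset_of_mutual_le h' l1 l2)

/-- The type of data parametrizing the orbits. -/
abbrev Datum (l : ℕ) : Type :=
  {p : Equiv.Perm (Fin (2 * l + 1)) × Finset (Fin (2 * l + 1)) // IsDatum p.1 p.2}

/-- The orbit attached to a datum. -/
noncomputable def datumOrbit (p : Datum l) : OrbitSet l :=
  Quotient.mk _ (datumRep p.2 • stdBorel l)

/-- Transitivity on Borel subalgebras and the stabilizer B turn orbits into double cosets, where the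
existence and uniqueness of normal forms apply. -/
lemma datumOrbit_bijective : Function.Bijective (datumOrbit (l := l)) := by
  constructor
  · rintro ⟨⟨σ, A⟩, h⟩ ⟨⟨σ', A'⟩, h'⟩ he
    obtain ⟨⟨k, hk⟩, e⟩ := MulAction.orbitRel_apply.mp (Quotient.exact he.symm)
    have e' : (k * datumRep h) • stdBorel l = datumRep h' • stdBorel l := by
      rw [mul_smul]; exact e
    have hb : (datumRep h')⁻¹ * (k * datumRep h) ∈ upperBorel (2 * l + 1) := by
      apply mem_upperBorel_of_smul_stdBorel
      rw [mul_smul, e', inv_smul_smul]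
    obtain ⟨h1, h2⟩ := datum_eq_of_mul_datumRep_eq h h' hk hb (by group)
    exact Subtype.ext (Prod.ext h1 h2)
  · intro q
    induction q using Quotient.inductionOn with
    | h b =>
      obtain ⟨g, rfl⟩ := exists_smul_stdBorel b
      obtain ⟨σ, A, h, k, hk, c, hc, rfl⟩ := exists_eq_mul_datumRep_mul g
      refine ⟨⟨⟨σ, A⟩, h⟩, Quotient.sound (MulAction.orbitRel_apply.mpr ⟨⟨k⁻¹, inv_mem hk⟩, ?_⟩)⟩
      change k⁻¹ • (k * datumRep h * c) • stdBorel l = datumRep h • stdBorel l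
      rw [mul_smul, mul_smul, smul_stdBorel_of_mem_upperBorel hc, inv_smul_smul]

end OrthoFlag

namespace OrthoFlag

/-! ### Permutations increasing on a subset -/

section IncreasingPerms

variable {l : ℕ}

/-- The permutations increasing on `A`, composed with the permutations of `A`, give every
permutation exactly once. -/
lemma bijective_mul_ofSubtype (A : Finset (Fin l)) :
    Function.Bijective fun q : {p : Equiv.Perm (Fin l) // StrictMonoOn p A} × Equiv.Perm A =>
      q.1.1 * Equiv.Perm.ofSubtype q.2 := by
  constructor
  · rintro ⟨⟨p, hp⟩, π⟩ ⟨⟨p', hp'⟩, π'⟩ he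
    simp only at he
    have key : ∀ x : A, p' ((π' * π⁻¹) x) = p x := by
      intro x
      have := Equiv.congr_fun he (π⁻¹ x)
      simp only [Equiv.Perm.mul_apply, Equiv.Perm.ofSubtype_apply_coe] at this
      simpa using this.symm
    have hmono : ∀ x y : A, (π' * π⁻¹) x ≤ (π' * π⁻¹) y ↔ x ≤ y := by
      intro x y
      rw [← Subtype.coe_le_coe, ← hp'.le_iff_le ((π' * π⁻¹) x).2 ((π' * π⁻¹) y).2, key, key,
        hp.le_iff_le x.2 y.2, Subtype.coe_le_coe]
    -- Two factorizations of one permutation differ by an order automorphism of the finite chain A,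
    -- which is the identity.
    let o : A ≃o A := ⟨π' * π⁻¹, hmono _ _⟩
    have ho : o = OrderIso.refl A := Subsingleton.elim _ _
    have h1 : π' * π⁻¹ = 1 := Equiv.ext fun x => DFunLike.congr_fun ho x
    have h2 : π' = π := mul_inv_eq_one.mp h1
    subst h2
    have h3 := mul_right_cancel he
    subst h3
    rfl
  · intro q
    let e := A.orderIsoOfFin rfl
    let f : Fin A.card → Fin l := fun i => q (e i)
    -- Sorting the values of q on A yields the permutation of A that makes q increasing there.
    let s := Tuple.sort f
    have hs : StrictMono (f ∘ s) := (Tuple.monotone_sort f).strictMono_of_injective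
      ((q.injective.comp (Subtype.val_injective.comp e.injective)).comp s.injective)
    let π : Equiv.Perm A := (e.toEquiv.symm.trans s).trans e.toEquiv
    refine ⟨⟨⟨q * Equiv.Perm.ofSubtype π, ?_⟩, π⁻¹⟩, ?_⟩
    · intro x hx y hy hxy
      have h1 : ∀ (x) (hx : x ∈ A), (q * Equiv.Perm.ofSubtype π) x = f (s (e.symm ⟨x, hx⟩)) := by
        intro x hx
        have : Equiv.Perm.ofSubtype π x = π ⟨x, hx⟩ :=
          Equiv.Perm.ofSubtype_apply_coe π ⟨x, hx⟩
        rw [Equiv.Perm.mul_apply, this]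
        rfl
      rw [h1 x hx, h1 y hy]
      exact hs (e.symm.strictMono hxy)
    · simp [mul_assoc]

lemma card_strictMonoOn_perm (A : Finset (Fin l)) :
    Nat.card {p : Equiv.Perm (Fin l) // StrictMonoOn p A} * (A.card)! = l ! := by
  have h := Nat.card_congr (Equiv.ofBijective _ (bijective_mul_ofSubtype A))
  rw [Nat.card_prod, Nat.card_eq_fintype_card (α := Equiv.Perm A),
    Nat.card_eq_fintype_card (α := Equiv.Perm (Fin l)), Fintype.card_perm, Fintype.card_perm,
    Fintype.card_coe, Fintype.card_fin] at h
  exact h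

end IncreasingPerms

/-! ### Signed permutations and the number of data -/

section SignedPerms

variable {l : ℕ}

/-- The index of `e_i` (if `b` is false) or of `e_{-i}` (if `b` is true). -/
def signedIndex (i : Fin l) (b : Bool) : Fin (2 * l + 1) :=
  if b then Fin.rev ⟨i, by omega⟩ else ⟨i, by omega⟩

lemma signedIndex_false (i : Fin l) : (signedIndex i false).val = i.val := rfl

lemma signedIndex_true (i : Fin l) : (signedIndex i true).val = 2 * l - i.val := by
  simp only [signedIndex, if_true, Fin.val_rev]
  omega

lemma rev_signedIndex (i : Fin l) (b : Bool) : (signedIndex i b).rev = signedIndex i (!b) := by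
  cases b <;> simp [signedIndex]

lemma signedIndex_injective {i j : Fin l} {b c : Bool} (h : signedIndex i b = signedIndex j c) :
    i = j ∧ b = c := by
  have h' := congrArg Fin.val h
  cases b <;> cases c <;> simp only [signedIndex_false, signedIndex_true] at h'
  · exact ⟨Fin.ext h', rfl⟩
  · omega
  · omega
  · exact ⟨Fin.ext (by omega), rfl⟩

lemma signedIndex_lt_mid_iff {i : Fin l} {b : Bool} : signedIndex i b < mid l ↔ b = false := by
  rw [Fin.lt_def]
  cases b <;> simp only [signedIndex_false, signedIndex_true, mid]
  · simp
  · simp; omega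

lemma mid_lt_signedIndex_iff {i : Fin l} {b : Bool} : mid l < signedIndex i b ↔ b = true := by
  rw [Fin.lt_def]
  cases b <;> simp only [signedIndex_false, signedIndex_true, mid]
  · simp
  · simp; omega

lemma signedIndex_ne_mid (i : Fin l) (b : Bool) : signedIndex i b ≠ mid l := by
  cases b
  · exact (signedIndex_lt_mid_iff.mpr rfl).ne
  · exact (mid_lt_signedIndex_iff.mpr rfl).ne'

lemma exists_signedIndex_of_lt {x : Fin (2 * l + 1)} (h : x < mid l) :
    ∃ i, x = signedIndex i false :=
  ⟨⟨x.val, h⟩, rfl⟩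

lemma exists_signedIndex {x : Fin (2 * l + 1)} (h : x ≠ mid l) : ∃ i b, x = signedIndex i b := by
  rcases lt_or_gt_of_ne h with h | h
  · obtain ⟨i, hi⟩ := exists_signedIndex_of_lt h
    exact ⟨i, false, hi⟩
  · obtain ⟨i, hi⟩ := exists_signedIndex_of_lt (rev_lt_mid_iff.mpr h)
    refine ⟨i, true, ?_⟩
    rw [← Fin.rev_rev x, hi, rev_signedIndex]
    rfl

/-- The map on indices determined by a permutation `p` of `{1, …, l}` and the set `E` of the indices
whose sign changes. -/
def signedMap (p : Equiv.Perm (Fin l)) (E : Finset (Fin l)) (x : Fin (2 * l + 1)) :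
    Fin (2 * l + 1) :=
  if h : x.val < l then signedIndex (p ⟨x, h⟩) (decide (⟨x, h⟩ ∈ E)) else
    if h : x.rev.val < l then signedIndex (p ⟨x.rev, h⟩) (!decide (⟨x.rev, h⟩ ∈ E)) else x

lemma signedMap_mid (p : Equiv.Perm (Fin l)) (E : Finset (Fin l)) :
    signedMap p E (mid l) = mid l := by
  have h : ¬ (mid l).val < l := lt_irrefl l
  rw [signedMap, dif_neg h, rev_mid, dif_neg h]

lemma signedMap_false (p : Equiv.Perm (Fin l)) (E : Finset (Fin l)) (i : Fin l) :
    signedMap p E (signedIndex i false) = signedIndex (p i) (decide (i ∈ E)) := by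
  have h : (signedIndex i false).val < l := i.2
  rw [signedMap, dif_pos h]
  rfl

lemma signedMap_true (p : Equiv.Perm (Fin l)) (E : Finset (Fin l)) (i : Fin l) :
    signedMap p E (signedIndex i true) = signedIndex (p i) (!decide (i ∈ E)) := by
  have h1 : ¬ (signedIndex i true).val < l := by rw [signedIndex_true]; omega
  have h2 : (signedIndex i true).rev = signedIndex i false := by rw [rev_signedIndex]; rfl
  have h3 : (signedIndex i true).rev.val < l := by rw [h2]; exact i.2
  have h4 : (⟨(signedIndex i true).rev.val, h3⟩ : Fin l) = i := by
    ext
    simp only [h2, signedIndex_false]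
  rw [signedMap, dif_neg h1, dif_pos h3, h4]

lemma signedMap_signedIndex (p : Equiv.Perm (Fin l)) (E : Finset (Fin l)) (i : Fin l) (b : Bool) :
    signedMap p E (signedIndex i b) = signedIndex (p i) (xor b (decide (i ∈ E))) := by
  cases b
  · rw [signedMap_false, Bool.false_xor]
  · rw [signedMap_true, Bool.true_xor]

lemma signedMap_injective (p : Equiv.Perm (Fin l)) (E : Finset (Fin l)) :
    Function.Injective (signedMap p E) := by
  intro x y h
  by_cases hx : x = mid l
  · by_cases hy : y = mid l
    · rw [hx, hy]
    · obtain ⟨j, c, rfl⟩ := exists_signedIndex hy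
      rw [hx, signedMap_mid, signedMap_signedIndex] at h
      exact absurd h.symm (signedIndex_ne_mid _ _)
  · obtain ⟨i, b, rfl⟩ := exists_signedIndex hx
    by_cases hy : y = mid l
    · rw [hy, signedMap_mid, signedMap_signedIndex] at h
      exact absurd h (signedIndex_ne_mid _ _)
    · obtain ⟨j, c, rfl⟩ := exists_signedIndex hy
      rw [signedMap_signedIndex, signedMap_signedIndex] at h
      obtain ⟨h1, h2⟩ := signedIndex_injective h
      obtain rfl := p.injective h1
      rw [Bool.xor_left_inj.mp h2]

/-- The permutation of the indices attached to a signed permutation. -/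
noncomputable def signedPerm (p : Equiv.Perm (Fin l)) (E : Finset (Fin l)) :
    Equiv.Perm (Fin (2 * l + 1)) :=
  Equiv.ofBijective _ (Finite.injective_iff_bijective.mp (signedMap_injective p E))

lemma signedPerm_apply (p : Equiv.Perm (Fin l)) (E : Finset (Fin l)) (x : Fin (2 * l + 1)) :
    signedPerm p E x = signedMap p E x := rfl

lemma signedPerm_rev (p : Equiv.Perm (Fin l)) (E : Finset (Fin l)) (x : Fin (2 * l + 1)) :
    signedPerm p E x.rev = (signedPerm p E x).rev := by
  simp only [signedPerm_apply]
  by_cases hx : x = mid l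
  · rw [hx, rev_mid, signedMap_mid, rev_mid]
  · obtain ⟨i, b, rfl⟩ := exists_signedIndex hx
    rw [rev_signedIndex, signedMap_signedIndex, signedMap_signedIndex, rev_signedIndex,
      Bool.not_xor]

lemma exists_signedPerm {τ : Equiv.Perm (Fin (2 * l + 1))} (hτ : ∀ i, τ i.rev = (τ i).rev) :
    ∃ p E, τ = signedPerm p E := by
  have hm := map_mid hτ
  have hex : ∀ i, ∃ j b, τ (signedIndex i false) = signedIndex j b := fun i =>
    exists_signedIndex fun h => signedIndex_ne_mid i false (τ.injective (h.trans hm.symm))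
  choose f s hf using hex
  have hinj : Function.Injective f := by
    intro i j hij
    by_cases hs : s i = s j
    · have : τ (signedIndex i false) = τ (signedIndex j false) := by rw [hf, hf, hij, hs]
      exact (signedIndex_injective (τ.injective this)).1
    -- Equal targets with opposite signs would identify the images of e_i and e_{-j}, contradicting
    -- injectivity of τ.
    · have : τ (signedIndex i false) = τ (signedIndex j true) := by
        have e : signedIndex j true = (signedIndex j false).rev := by rw [rev_signedIndex]; rfl
        rw [e, hτ, hf, hf, rev_signedIndex, hij]
        congr 1
        revert hs
        cases s i <;> cases s j <;> simp
      exact (signedIndex_injective (τ.injective this)).1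
  let p : Equiv.Perm (Fin l) := Equiv.ofBijective f (Finite.injective_iff_bijective.mp hinj)
  let E : Finset (Fin l) := Finset.univ.filter fun i => s i = true
  have hfalse : ∀ i, τ (signedIndex i false) = signedPerm p E (signedIndex i false) := fun i => by
    have hE : decide (i ∈ E) = s i := by simp [E]
    rw [signedPerm_apply, signedMap_false, hf, hE]
    rfl
  refine ⟨p, E, Equiv.ext fun x => ?_⟩
  by_cases hx : x = mid l
  · rw [hx, hm, signedPerm_apply, signedMap_mid]
  · obtain ⟨i, b, rfl⟩ := exists_signedIndex hx
    cases b
    · exact hfalse i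
    · have e : signedIndex i true = (signedIndex i false).rev := by rw [rev_signedIndex]; rfl
      rw [e, hτ, signedPerm_rev, hfalse]

lemma signedPerm_injective {p p' : Equiv.Perm (Fin l)} {E E' : Finset (Fin l)}
    (h : signedPerm p E = signedPerm p' E') : p = p' ∧ E = E' := by
  have key : ∀ i, p i = p' i ∧ decide (i ∈ E) = decide (i ∈ E') := fun i => by
    have := Equiv.congr_fun h (signedIndex i false)
    rw [signedPerm_apply, signedPerm_apply, signedMap_false, signedMap_false] at this
    exact signedIndex_injective this
  refine ⟨Equiv.ext fun i => (key i).1, ?_⟩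
  ext i
  exact decide_eq_decide.mp (key i).2

/-- Positive indices among all indices. -/
def lowEmb (l : ℕ) : Fin l ↪ Fin (2 * l + 1) :=
  ⟨fun i => signedIndex i false, fun _ _ h => (signedIndex_injective h).1⟩

/-- Data in terms of permutations of `{1, …, l}` and sets of signs. -/
abbrev SignedDatum (l : ℕ) : Type :=
  Σ A : Finset (Fin l), {p : Equiv.Perm (Fin l) // StrictMonoOn p A} × {E : Finset (Fin l) // A ⊆ E}

/-- The index of e_{-i} is 2l - i, so on A, where all signs change, σ⁻¹ is decreasing exactly when p
is increasing. -/
lemma isDatum_signedPerm_iff (p : Equiv.Perm (Fin l)) (E A : Finset (Fin l)) :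
    IsDatum (signedPerm p E).symm (A.map (lowEmb l)) ↔ A ⊆ E ∧ StrictMonoOn p A := by
  have hval : ∀ i, signedPerm p E (lowEmb l i) = signedIndex (p i) (decide (i ∈ E)) := fun i =>
    signedMap_false p E i
  have hlow : ∀ i, lowEmb l i < mid l := fun i => signedIndex_lt_mid_iff.mpr rfl
  have hE : (∀ i ∈ A.map (lowEmb l), i < mid l ∧ mid l < (signedPerm p E).symm.symm i) ↔
      A ⊆ E := by
    simp only [Finset.mem_map, forall_exists_index, and_imp, forall_apply_eq_imp_iff₂,
      Equiv.symm_symm, hval, mid_lt_signedIndex_iff, decide_eq_true_eq, hlow, true_and]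
    rfl
  rw [IsDatum, hE]
  constructor
  · rintro ⟨-, h1, h2⟩
    refine ⟨h1, fun i hi j hj hij => ?_⟩
    have := h2 _ (Finset.mem_map_of_mem _ hi) _ (Finset.mem_map_of_mem _ hj)
      (show lowEmb l i < lowEmb l j from hij)
    rw [Equiv.symm_symm, hval, hval, decide_eq_true (h1 hi), decide_eq_true (h1 hj), Fin.lt_def,
      signedIndex_true, signedIndex_true] at this
    exact Fin.lt_def.mpr (by omega)
  · rintro ⟨h1, h2⟩
    refine ⟨symm_rev (signedPerm_rev p E), h1, fun x hx y hy hxy => ?_⟩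
    obtain ⟨i, hi, rfl⟩ := Finset.mem_map.mp hx
    obtain ⟨j, hj, rfl⟩ := Finset.mem_map.mp hy
    have := Fin.lt_def.mp (h2 hi hj (show i < j from hxy))
    rw [Equiv.symm_symm, hval, hval, decide_eq_true (h1 hi), decide_eq_true (h1 hj), Fin.lt_def,
      signedIndex_true, signedIndex_true]
    omega

/-- The datum attached to a signed datum. -/
noncomputable def SignedDatum.toDatum (q : SignedDatum l) : Datum l :=
  ⟨((signedPerm q.2.1.1 q.2.2.1).symm, q.1.map (lowEmb l)),
    (isDatum_signedPerm_iff _ _ _).mpr ⟨q.2.2.2, q.2.1.2⟩⟩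

lemma SignedDatum.toDatum_bijective : Function.Bijective (SignedDatum.toDatum (l := l)) := by
  constructor
  · rintro ⟨A, ⟨p, hp⟩, ⟨E, hE⟩⟩ ⟨A', ⟨p', hp'⟩, ⟨E', hE'⟩⟩ h
    have h0 := congrArg Subtype.val h
    obtain ⟨h1, h2⟩ := Prod.ext_iff.mp h0
    obtain rfl : A = A' := Finset.map_injective _ h2
    obtain ⟨rfl, rfl⟩ := signedPerm_injective (congrArg Equiv.symm h1)
    rfl
  · rintro ⟨⟨σ, A'⟩, h⟩
    obtain ⟨p, E, hpE⟩ := exists_signedPerm (symm_rev h.1)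
    obtain rfl : σ = (signedPerm p E).symm := by rw [← hpE]; rfl
    obtain ⟨A, rfl⟩ : ∃ A : Finset (Fin l), A' = A.map (lowEmb l) := by
      refine ⟨Finset.univ.filter fun i => lowEmb l i ∈ A', ?_⟩
      ext x
      simp only [Finset.mem_map, Finset.mem_filter, Finset.mem_univ, true_and]
      constructor
      · intro hx
        obtain ⟨i, rfl⟩ := exists_signedIndex_of_lt (h.2.1 x hx).1
        exact ⟨i, hx, rfl⟩
      · rintro ⟨i, hi, rfl⟩
        exact hi
    obtain ⟨h1, h2⟩ := (isDatum_signedPerm_iff p E A).mp h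
    exact ⟨⟨A, ⟨p, h2⟩, ⟨E, h1⟩⟩, rfl⟩

lemma card_superset (A : Finset (Fin l)) :
    Nat.card {E : Finset (Fin l) // A ⊆ E} = 2 ^ (l - A.card) := by
  have h := Finset.card_Icc_finset (Finset.subset_univ A)
  rw [Finset.card_univ, Fintype.card_fin] at h
  rw [← h, Nat.subtype_card]
  simp

/-- A set A of size k admits l!/k! permutations increasing on it and 2^(l-k) sign sets containing
it; the sum is then grouped by k. -/
lemma card_datum : (Nat.card (Datum l) : ℚ) =
    ∑ k ∈ Finset.range (l + 1), (l.choose k : ℚ) * ((l ! : ℚ) / (k ! : ℚ) * 2 ^ (l - k)) := by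
  rw [← Nat.card_congr (Equiv.ofBijective _ SignedDatum.toDatum_bijective), Nat.card_sigma]
  have h : ∀ A : Finset (Fin l), (Nat.card ({p : Equiv.Perm (Fin l) // StrictMonoOn p A} ×
      {E : Finset (Fin l) // A ⊆ E}) : ℚ) = (l ! : ℚ) / ((A.card)! : ℚ) * 2 ^ (l - A.card) := by
    intro A
    rw [Nat.card_prod, card_superset, ← card_strictMonoOn_perm A]
    have : ((A.card)! : ℚ) ≠ 0 := by exact_mod_cast Nat.factorial_ne_zero _
    push_cast
    field_simp
  rw [Nat.cast_sum, Finset.sum_congr rfl fun A _ => h A]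
  have := Finset.sum_powerset_apply_card (fun k => (l ! : ℚ) / (k ! : ℚ) * 2 ^ (l - k))
    (x := (Finset.univ : Finset (Fin l)))
  rw [Finset.powerset_univ, Finset.card_univ, Fintype.card_fin] at this
  rw [this]
  exact Finset.sum_congr rfl fun k _ => nsmul_eq_mul _ _

end SignedPerms

end OrthoFlag

namespace OrthoFlag

/-! ### The exponential generating function -/

section Series

open PowerSeries

/-- The negative binomial series, rescaled by X ↦ 2X. -/
lemma inv_one_sub_two_X_pow (k : ℕ) :
    ((1 - 2 * X : PowerSeries ℂ)⁻¹) ^ (k + 1) =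
      PowerSeries.mk fun m => ((k + m).choose k : ℂ) * 2 ^ m := by
  have hc : constantCoeff (1 - 2 * X : PowerSeries ℂ) ≠ 0 := by simp
  have h1 := congrArg (rescale (2 : ℂ)) (mk_add_choose_mul_one_sub_pow_eq_one ℂ k)
  have hX : rescale (2 : ℂ) (1 - X) = 1 - 2 * X := by
    rw [map_sub, map_one, rescale_X]; rfl
  rw [map_mul, map_pow, map_one, hX] at h1
  have h2 : (1 - 2 * X : PowerSeries ℂ)⁻¹ ^ (k + 1) * (1 - 2 * X) ^ (k + 1) = 1 := by
    rw [← mul_pow, PowerSeries.inv_mul_cancel _ hc, one_pow]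
  have h3 : (1 - 2 * X : PowerSeries ℂ) ^ (k + 1) ≠ 0 := fun h0 => by
    rw [h0, mul_zero] at h2
    exact zero_ne_one h2
  rw [mul_right_cancel₀ h3 (h2.trans h1.symm)]
  ext m
  rw [coeff_rescale, coeff_mk, coeff_mk, mul_comm]

/-- Expanding the exponential gives the terms X^k (1 - 2X)^(-(k+1)) / k!, whose coefficients come
from the negative binomial series. -/
lemma coeff_exp_subst_mul (l : ℕ) :
    coeff l ((PowerSeries.exp ℂ).subst (X * (1 - 2 * X : PowerSeries ℂ)⁻¹ : PowerSeries ℂ) *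
        (1 - 2 * X : PowerSeries ℂ)⁻¹) =
      ∑ k ∈ Finset.range (l + 1), (l.choose k : ℂ) * (1 / (k ! : ℂ) * 2 ^ (l - k)) := by
  set g := (1 - 2 * X : PowerSeries ℂ)⁻¹ with hg
  have hs : HasSubst (X * g) := HasSubst.of_constantCoeff_zero' (by simp)
  have hsub : ∀ n ≤ l, coeff n ((PowerSeries.exp ℂ).subst (X * g)) =
      ∑ k ∈ Finset.range (l + 1), (1 / (k ! : ℂ)) * coeff n ((X * g) ^ k) := by
    intro n hn
    -- Terms with k > l do not contribute, since X^k divides them; this gives one finite range for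
    -- all n ≤ l.
    rw [coeff_subst' hs, finsum_eq_sum_of_support_subset]
    · refine Finset.sum_congr rfl fun k _ => ?_
      rw [coeff_exp, smul_eq_mul]
      simp
    · intro k hk
      rw [Function.mem_support] at hk
      simp only [Finset.coe_range, Set.mem_Iio]
      by_contra hlt
      apply hk
      rw [mul_pow, coeff_X_pow_mul', if_neg (by omega), smul_zero]
  have hx : ∀ x ∈ Finset.HasAntidiagonal.antidiagonal l,
      coeff x.1 ((PowerSeries.exp ℂ).subst (X * g)) * coeff x.2 g =
        ∑ k ∈ Finset.range (l + 1), (1 / (k ! : ℂ)) * coeff x.1 ((X * g) ^ k) * coeff x.2 g :=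
    fun x hx => by
      have := Finset.HasAntidiagonal.mem_antidiagonal.mp hx
      rw [hsub x.1 (by omega), Finset.sum_mul]
  rw [coeff_mul, Finset.sum_congr rfl hx, Finset.sum_comm]
  refine Finset.sum_congr rfl fun k hk => ?_
  have hkl : k ≤ l := Nat.lt_succ_iff.mp (Finset.mem_range.mp hk)
  simp only [mul_assoc]
  rw [← Finset.mul_sum, ← coeff_mul, mul_pow, mul_assoc, ← pow_succ, hg, inv_one_sub_two_X_pow,
    coeff_X_pow_mul', if_pos hkl, coeff_mk, Nat.add_sub_cancel' hkl]
  ring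

end Series

end OrthoFlag

theorem propositionp :
    (∀ l : ℕ, Finite (OrthoFlag.OrbitSet l)) ∧
    OrthoFlag.expGenFun (fun l : ℕ => (Nat.card (OrthoFlag.OrbitSet l) : ℂ)) =
      (PowerSeries.exp ℂ).subst
          (PowerSeries.X * (1 - 2 * PowerSeries.X : PowerSeries ℂ)⁻¹ : PowerSeries ℂ) *
        (1 - 2 * PowerSeries.X : PowerSeries ℂ)⁻¹ := by
  refine ⟨fun l => Finite.of_surjective _ OrthoFlag.datumOrbit_bijective.2, ?_⟩
  ext l
  rw [OrthoFlag.coeff_exp_subst_mul, OrthoFlag.expGenFun, PowerSeries.coeff_mk,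
    ← Nat.card_congr (Equiv.ofBijective _ (OrthoFlag.datumOrbit_bijective (l := l)))]
  have h := congrArg (Rat.cast : ℚ → ℂ) (OrthoFlag.card_datum (l := l))
  push_cast at h
  -- Division by l! cancels the factor l! of each term of the count, leaving the coefficient of the
  -- series.
  rw [h, Finset.sum_div]
  refine Finset.sum_congr rfl fun k _ => ?_
  have : (l ! : ℂ) ≠ 0 := by exact_mod_cast Nat.factorial_ne_zero l
  field_simp
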